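/- Let $\gamma\in(1,3]$ and $\theta=\frac{\gamma-1}{2}$, and consider the isentropic Carrollian fluid equations $$\partial_t(\beta\sigma)+\partial_x\sigma=0,\qquad \partial_t\big(\gamma^{-1}\sigma^\gamma+\beta^2\sigma\big)+\partial_x(\beta\sigma)=0 .$$ A $C^1$ solution on $[0,T]\times\mathbb R$ with initial data $(\sigma_0,\beta_0)$ is a pair $\sigma,\beta\in C^1([0,T]\times\mathbb R)$ with $\sigma\ge0$ which satisfies both equations pointwise on $(0,T)\times\mathbb R$ and $(\sigma,\beta)(0,\cdot)=(\sigma_0,\beta_0)$. Write $w_1=\beta+\sigma^\theta/\theta$ and $w_2=\beta-\sigma^\theta/\theta$, $w_j(t,\cdot)=w_j(\sigma(t,\cdot),\beta(t,\cdot))$ and $w_j(0,\cdot)=w_j(\sigma_0,\beta_0)$. For a given $t$ consider the conditions $$\text{(A)}\quad \inf_{\mathbb R}w_1(t,\cdot)>0>\sup_{\mathbb R}w_2(t,\cdot),$$ $$\text{(B)}\quad \begin{cases}\big(\sup_{\mathbb R}w_1(t,\cdot)-\theta\inf_{\mathbb R}w_1(t,\cdot)\big)+(1+\theta)\sup_{\mathbb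 R}w_2(t,\cdot)<0,\\ (1+\theta)\inf_{\mathbb R}w_1(t,\cdot)-\big(\theta\sup_{\mathbb R}w_2(t,\cdot)-\inf_{\mathbb R}w_2(t,\cdot)\big)>0,\end{cases}$$ where (B) includes that the four extrema are finite. **Proposition (local well-posedness).** Let $\sigma_0,\beta_0\in C^1(\mathbb R)$ have bounded derivatives, let $\sigma_0\ge0$, and suppose that (A) holds at $t=0$ and, if $\gamma\in(1,3)$, that (B) also holds at $t=0$. Then there is $T>0$ such that there exists a unique $C^1$ solution $(\sigma,\beta)$ on $[0,T]\times\mathbb R$ with initial data $(\sigma_0,\beta_0)$. Moreover, (A) holds for every $t\in[0,T]$ and, if $\gamma\in(1,3)$, so does (B). -/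

import Mathlib

namespace Carroll

noncomputable section

/-- The exponent `θ = (γ - 1) / 2`. -/
def theta (γ : ℝ) : ℝ := (γ - 1) / 2

/-- The Riemann invariant `w₁(σ, β) = β + σ ^ θ / θ`. -/
def w1 (γ σ β : ℝ) : ℝ := β + σ ^ theta γ / theta γ

/-- The Riemann invariant `w₂(σ, β) = β - σ ^ θ / θ`. -/
def w2 (γ σ β : ℝ) : ℝ := β - σ ^ theta γ / theta γ

/-- The state `(s, b)`, a pair of functions of the space variable, satisfies
`inf w₁ > 0 > sup w₂`. The first two clauses say that this infimum and this supremum are finite. -/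
def SignCondition (γ : ℝ) (s b : ℝ → ℝ) : Prop :=
  BddBelow (Set.range fun x => w1 γ (s x) (b x)) ∧
  BddAbove (Set.range fun x => w2 γ (s x) (b x)) ∧
  0 < (⨅ x, w1 γ (s x) (b x)) ∧
  (⨆ x, w2 γ (s x) (b x)) < 0

/-- The state `(s, b)` satisfies
`(sup w₁ - θ inf w₁) + (1 + θ) sup w₂ < 0` and `(1 + θ) inf w₁ - (θ sup w₂ - inf w₂) > 0`.
The first two clauses say that all four extrema are finite: with `sup w₁ = +∞` or
`inf w₂ = -∞` one of the inequalities fails. -/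
def HyperbolicityCondition (γ : ℝ) (s b : ℝ → ℝ) : Prop :=
  Bornology.IsBounded (Set.range fun x => w1 γ (s x) (b x)) ∧
  Bornology.IsBounded (Set.range fun x => w2 γ (s x) (b x)) ∧
  ((⨆ x, w1 γ (s x) (b x)) - theta γ * ⨅ x, w1 γ (s x) (b x))
      + (1 + theta γ) * (⨆ x, w2 γ (s x) (b x)) < 0 ∧
  0 < (1 + theta γ) * (⨅ x, w1 γ (s x) (b x))
      - (theta γ * (⨆ x, w2 γ (s x) (b x)) - ⨅ x, w2 γ (s x) (b x))

/-- `(σ, β)` is a `C¹` solution on `[0, T] × ℝ` of the isentropic Carrollian fluid equations.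
The first argument of `σ` and `β` is time, the second one is space. -/
structure IsC1Solution (γ T : ℝ) (σ β : ℝ → ℝ → ℝ) : Prop where
  contDiffOn_sigma : ContDiffOn ℝ 1 (Function.uncurry σ) (Set.Icc 0 T ×ˢ Set.univ)
  contDiffOn_beta : ContDiffOn ℝ 1 (Function.uncurry β) (Set.Icc 0 T ×ˢ Set.univ)
  sigma_nonneg : ∀ t ∈ Set.Icc 0 T, ∀ x, 0 ≤ σ t x
  /-- `∂ₜ(βσ) + ∂ₓσ = 0` -/
  energy : ∀ t ∈ Set.Ioo 0 T, ∀ x,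
    deriv (fun s => β s x * σ s x) t + deriv (fun y => σ t y) x = 0
  /-- `∂ₜ(γ⁻¹ σ ^ γ + β² σ) + ∂ₓ(βσ) = 0` -/
  momentum : ∀ t ∈ Set.Ioo 0 T, ∀ x,
    deriv (fun s => γ⁻¹ * σ s x ^ γ + β s x ^ 2 * σ s x) t
      + deriv (fun y => β t y * σ t y) x = 0

/-- `(σ, β)` is a `C¹` solution on `[0, T] × ℝ` of the Cauchy problem with data `(σ₀, β₀)`. -/
structure IsC1CauchySolution (γ T : ℝ) (σ₀ β₀ : ℝ → ℝ) (σ β : ℝ → ℝ → ℝ) : Prop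
    extends IsC1Solution γ T σ β where
  sigma_zero : ∀ x, σ 0 x = σ₀ x
  beta_zero : ∀ x, β 0 x = β₀ x

end

end Carroll

/-! Away from vacuum the Riemann invariants W = w₁ and Z = w₂ diagonalize the equations: W_t +
W_x/λ₁ = 0 and Z_t + Z_x/λ₂ = 0, where λ₁ = β + σ^θ and λ₂ = β - σ^θ are convex combinations of W
and Z with weights (1 ± θ)/2. Condition (B), or (A) when γ = 3, gives λ₁ ≥ c > 0 and λ₂ ≤ -c even
when W and Z are initial values taken at different points (`exists_eigenvalue_bound`).

Existence is a hodograph argument. Label a space-time point by the feet a and b of its two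
characteristics. There W = f(a) and Z = g(b) with f, g the initial invariants, so λ₁ and λ₂ are
known functions of (a, b), and the unknowns t, x solve the linear system t_b = λ₁ x_b, t_a = λ₂ x_a.
Compatibility of the mixed derivatives becomes a linear Goursat system with bounded coefficients
(`exists_goursat`), whose solution yields t and x as potentials
(`exists_characteristic_coordinates`). The diagonal a = b is the initial line, and all bounds are
uniform along it, so (a, b) ↦ (t, x) can be inverted over a full strip |t| < T
(`exists_inverse_near_diagonal`). Since W and Z take only initial values, (A) and (B) persist at
once.

For uniqueness, the squared differences of the invariants of two solutions are differentiated along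
the characteristics of the competitor, where its own invariant is constant. Only the derivative of
the constructed solution enters, and that is bounded. A maximum principle on backward cones
(`nonpos_of_directional_deriv_le`) concludes. It needs the inequality only where the difference is
small, and there the competitor cannot reach vacuum or lose the signs of its speeds. -/

open Set Filter Topology

/-! ### Potentials of closed one-forms -/

/-- A closed `1`-form `q da + p db` on the plane, whose coefficients have only the mixed partial
derivatives `∂p/∂a = ∂q/∂b`, has a `C¹` potential with prescribed values on the diagonal. -/
lemma exists_potential {p q r : ℝ → ℝ → ℝ} (hp : Continuous (Function.uncurry p))
    (hq : Continuous (Function.uncurry q)) (hr : Continuous (Function.uncurry r))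
    (hpr : ∀ a b, HasDerivAt (fun s => p s b) (r a b) a)
    (hqr : ∀ a b, HasDerivAt (fun s => q a s) (r a b) b)
    {φ : ℝ → ℝ} (hφ : ∀ a, HasDerivAt φ (p a a + q a a) a) :
    ∃ u : ℝ × ℝ → ℝ, ContDiff ℝ 1 u ∧
      (∀ z : ℝ × ℝ, HasFDerivAt u (q z.1 z.2 • ContinuousLinearMap.fst ℝ ℝ ℝ +
        p z.1 z.2 • ContinuousLinearMap.snd ℝ ℝ ℝ) z) ∧ ∀ a, u (a, a) = φ a := by
  have hp' : ∀ a, Continuous (p a) := fun a => hp.comp (Continuous.prodMk_right a)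
  have hq' : ∀ b, Continuous (fun a => q a b) := fun b => hq.comp (Continuous.prodMk_left b)
  have hr' : ∀ a, Continuous (r a) := fun a => hr.comp (Continuous.prodMk_right a)
  -- Integrating `p` vertically needs only its `a`-derivative: differentiating under the integral
  -- gives `∫ r`, which the `b`-derivative of `q` integrates back to `q a b - q a 0`.
  set v : ℝ → ℝ → ℝ := fun a b => (∫ s in (0 : ℝ)..b, p a s) + ∫ s in (0 : ℝ)..a, q s 0 with hv
  have hvb : ∀ a b, HasDerivAt (v a) (p a b) b := fun a b =>
    ((hp' a).integral_hasStrictDerivAt 0 b).hasDerivAt.add_const _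
  have hva : ∀ a b, HasDerivAt (fun s => v s b) (q a b) a := by
    intro a b
    have h1 : HasDerivAt (fun s => ∫ y in (0 : ℝ)..b, p s y) (∫ y in (0 : ℝ)..b, r a y) a := by
      obtain ⟨C, hC⟩ := ((isCompact_Icc (a := a - 1) (b := a + 1)).prod
        (isCompact_uIcc (a := (0 : ℝ)) (b := b))).exists_bound_of_continuousOn hr.continuousOn
      refine (intervalIntegral.hasDerivAt_integral_of_dominated_loc_of_deriv_le
        (μ := MeasureTheory.volume) (F := fun s y => p s y) (F' := fun s y => r s y)
        (s := Icc (a - 1) (a + 1)) (bound := fun _ => C)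
        (Icc_mem_nhds (by linarith) (by linarith)) ?_ ?_ ?_ ?_ ?_ ?_).2
      · exact Eventually.of_forall fun s => (hp' s).aestronglyMeasurable
      · exact (hp' a).intervalIntegrable _ _
      · exact (hr' a).aestronglyMeasurable
      · exact Eventually.of_forall fun y hy s hs => hC (s, y) ⟨hs, uIoc_subset_uIcc hy⟩
      · exact intervalIntegrable_const
      · exact Eventually.of_forall fun y _ s _ => hpr s y
    have h2 : (∫ y in (0 : ℝ)..b, r a y) = q a b - q a 0 :=
      intervalIntegral.integral_eq_sub_of_hasDerivAt (fun y _ => hqr a y)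
        ((hr' a).intervalIntegrable _ _)
    have h3 := h1.add ((hq' 0).integral_hasStrictDerivAt 0 a).hasDerivAt
    rw [h2] at h3
    simpa [hv] using! h3
  have hstrict : ∀ z : ℝ × ℝ, HasStrictFDerivAt (Function.uncurry v)
      (q z.1 z.2 • ContinuousLinearMap.fst ℝ ℝ ℝ +
        p z.1 z.2 • ContinuousLinearMap.snd ℝ ℝ ℝ) z := by
    intro z
    have := hasStrictFDerivAt_uncurry_coprod (𝕜 := ℝ) (u := z) (f := v)
      (f₁ := fun a b => ContinuousLinearMap.toSpanSingleton ℝ (q a b))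
      (f₂ := fun a b => ContinuousLinearMap.toSpanSingleton ℝ (p a b))
      (Eventually.of_forall fun y => (hva y.1 y.2).hasFDerivAt)
      (Eventually.of_forall fun y => (hvb y.1 y.2).hasFDerivAt)
      (by
        have : Continuous fun y : ℝ × ℝ => ContinuousLinearMap.toSpanSingleton ℝ (q y.1 y.2) :=
          (ContinuousLinearMap.toSpanSingletonCLE (𝕜 := ℝ) (E := ℝ)).continuous.comp hq
        exact this.continuousAt)
      (by
        have : Continuous fun y : ℝ × ℝ => ContinuousLinearMap.toSpanSingleton ℝ (p y.1 y.2) :=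
          (ContinuousLinearMap.toSpanSingletonCLE (𝕜 := ℝ) (E := ℝ)).continuous.comp hp
        exact this.continuousAt)
    refine this.congr_fderiv ?_
    ext <;> simp [Function.HasUncurry.uncurry]
  have hdiag : ∀ a, HasDerivAt (fun s => v s s) (p a a + q a a) a := by
    intro a
    have := (hstrict (a, a)).hasFDerivAt.comp_hasDerivAt (f := fun s : ℝ => (s, s)) a
      ((hasDerivAt_id a).prodMk (hasDerivAt_id a))
    refine this.congr_deriv ?_
    simp [add_comm]
  -- The potential is determined up to a constant, and by `hφ` it differs from `φ` on the diagonal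
  -- by a constant, which is subtracted.
  have hconst : ∀ a, v a a - φ a = v 0 0 - φ 0 := fun a =>
    is_const_of_deriv_eq_zero (f := fun s => v s s - φ s)
      (fun s => ((hdiag s).sub (hφ s)).differentiableAt)
      (fun s => by simpa using! ((hdiag s).sub (hφ s)).deriv) a 0
  have hfd : ∀ z : ℝ × ℝ, HasFDerivAt (fun z => Function.uncurry v z - (v 0 0 - φ 0))
      (q z.1 z.2 • ContinuousLinearMap.fst ℝ ℝ ℝ +
        p z.1 z.2 • ContinuousLinearMap.snd ℝ ℝ ℝ) z :=
    fun z => (hstrict z).hasFDerivAt.sub_const _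
  refine ⟨_, ?_, hfd, fun a => ?_⟩
  · rw [contDiff_one_iff_fderiv]
    refine ⟨fun z => (hfd z).differentiableAt, ?_⟩
    rw [show fderiv ℝ (fun z => Function.uncurry v z - (v 0 0 - φ 0)) = _ from
      funext fun z => (hfd z).fderiv]
    exact (hq.smul continuous_const).add (hp.smul continuous_const)
  · have := hconst a
    simp only [Function.uncurry]
    linarith

/-! ### The linear Goursat problem -/

/-- The Volterra operator `F ↦ ∫ s in b..a, F (s, b)`, conjugated with the weight
`cosh (L (a - b))`. -/
noncomputable def weightedVolterra (L : ℝ) (F : ℝ × ℝ → ℝ) (z : ℝ × ℝ) : ℝ :=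
  (∫ s in z.2..z.1, F (s, z.2) * Real.cosh (L * (s - z.2))) / Real.cosh (L * (z.1 - z.2))

lemma continuous_integral_fst {F : ℝ × ℝ → ℝ} (hF : Continuous F) :
    Continuous fun z : ℝ × ℝ => ∫ s in z.2..z.1, F (s, z.2) := by
  have h0 : ∀ b, Continuous fun s => F (s, b) := fun b => hF.comp (Continuous.prodMk_left b)
  have h : ∀ {e : ℝ × ℝ → ℝ}, Continuous e →
      Continuous fun z : ℝ × ℝ => ∫ s in (0 : ℝ)..e z, F (s, z.2) := fun he =>
    intervalIntegral.continuous_parametric_intervalIntegral_of_continuous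
      (f := fun (z : ℝ × ℝ) s => F (s, z.2)) (by fun_prop) he
  have h' := (h continuous_fst).sub (h continuous_snd)
  refine h'.congr fun z => ?_
  exact intervalIntegral.integral_interval_sub_left ((h0 _).intervalIntegrable _ _)
    ((h0 _).intervalIntegrable _ _)

lemma continuous_weightedVolterra (L : ℝ) {F : ℝ × ℝ → ℝ} (hF : Continuous F) :
    Continuous (weightedVolterra L F) := by
  have := continuous_integral_fst (F := fun z => F z * Real.cosh (L * (z.1 - z.2)))
    (by fun_prop)
  exact this.div (by fun_prop) fun z => (Real.cosh_pos _).ne'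

/-- The weight gains a factor `1 / L`, because `∫ cosh (L s) = sinh (L s) / L` and `|sinh| ≤ cosh`.
An even weight is used since the integral leaves the diagonal in both directions; it depends only on
`a - b`, so estimates are uniform along the diagonal. -/
lemma abs_weightedVolterra_le {L N : ℝ} (hL : 0 < L) {F : ℝ × ℝ → ℝ}
    (hN : ∀ z, |F z| ≤ N) (z : ℝ × ℝ) : |weightedVolterra L F z| ≤ N / L := by
  have hN0 : 0 ≤ N := (abs_nonneg _).trans (hN z)
  have h1 : |∫ s in z.2..z.1, F (s, z.2) * Real.cosh (L * (s - z.2))| ≤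
      |∫ s in z.2..z.1, N * Real.cosh (L * (s - z.2))| := by
    refine intervalIntegral.norm_integral_le_abs_of_norm_le
      (μ := MeasureTheory.volume) (f := fun s => F (s, z.2) * Real.cosh (L * (s - z.2)))
      (g := fun s => N * Real.cosh (L * (s - z.2))) (.of_forall fun s => ?_)
      (Continuous.intervalIntegrable (by fun_prop) _ _)
    rw [Real.norm_eq_abs, abs_mul, abs_of_pos (Real.cosh_pos _)]
    exact mul_le_mul_of_nonneg_right (hN _) (Real.cosh_pos _).le
  have h2 : (∫ s in z.2..z.1, N * Real.cosh (L * (s - z.2))) =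
      N / L * Real.sinh (L * (z.1 - z.2)) := by
    have := intervalIntegral.integral_eq_sub_of_hasDerivAt (a := z.2) (b := z.1)
      (f := fun s => N / L * Real.sinh (L * (s - z.2)))
      (f' := fun s => N * Real.cosh (L * (s - z.2))) (fun s _ => by
        have := ((((hasDerivAt_id s).sub_const z.2).const_mul L).sinh).const_mul (N / L)
        refine this.congr_deriv ?_
        simp only [id]
        field_simp) (Continuous.intervalIntegrable (by fun_prop) _ _)
    simpa using this
  rw [weightedVolterra, abs_div, abs_of_pos (Real.cosh_pos _), div_le_iff₀ (Real.cosh_pos _)]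
  refine h1.trans ?_
  rw [h2, abs_mul, abs_of_nonneg (by positivity)]
  refine mul_le_mul_of_nonneg_left ?_ (by positivity)
  rw [Real.abs_sinh, ← Real.cosh_abs (L * _)]
  exact (Real.sinh_lt_cosh _).le

lemma weightedVolterra_sub (L : ℝ) {F G : ℝ × ℝ → ℝ} (hF : Continuous F) (hG : Continuous G)
    (z : ℝ × ℝ) :
    weightedVolterra L F z - weightedVolterra L G z = weightedVolterra L (fun z => F z - G z) z := by
  simp only [weightedVolterra, sub_mul]
  have hi : ∀ {G : ℝ × ℝ → ℝ}, Continuous G → IntervalIntegrable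
      (fun s => G (s, z.2) * Real.cosh (L * (s - z.2))) MeasureTheory.volume z.2 z.1 :=
    fun hG => Continuous.intervalIntegrable (by fun_prop) _ _
  rw [intervalIntegral.integral_sub (hi hF) (hi hG), sub_div]

/-- The linear Goursat-type system `P_a = α₁ P + α₂ Q`, `Q_b = β₁ P + β₂ Q` with data `P = Q = 1`
on the diagonal `a = b`, in integrated form. -/
lemma exists_goursat_integral {α₁ α₂ β₁ β₂ : ℝ × ℝ → ℝ} {K : ℝ}
    (hα₁ : Continuous α₁) (hα₂ : Continuous α₂) (hβ₁ : Continuous β₁) (hβ₂ : Continuous β₂)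
    (bα₁ : ∀ z, |α₁ z| ≤ K) (bα₂ : ∀ z, |α₂ z| ≤ K)
    (bβ₁ : ∀ z, |β₁ z| ≤ K) (bβ₂ : ∀ z, |β₂ z| ≤ K) :
    ∃ (P Q : ℝ × ℝ → ℝ) (M L : ℝ), Continuous P ∧ Continuous Q ∧
      (∀ z, |P z| ≤ M * Real.cosh (L * (z.1 - z.2))) ∧
      (∀ z, |Q z| ≤ M * Real.cosh (L * (z.1 - z.2))) ∧
      (∀ a b, P (a, b) = 1 + ∫ s in b..a, (α₁ (s, b) * P (s, b) + α₂ (s, b) * Q (s, b))) ∧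
      ∀ a b, Q (a, b) = 1 + ∫ s in a..b, (β₁ (a, s) * P (a, s) + β₂ (a, s) * Q (a, s)) := by
  have hK : 0 ≤ K := (abs_nonneg _).trans (bα₁ 0)
  -- The fixed-point map below has Lipschitz constant at most `2 * K / L`, which this makes at most
  -- `1 / 2`.
  set L : ℝ := 4 * K + 1 with hLdef
  have hL : 0 < L := by positivity
  have hw : ∀ z : ℝ × ℝ, |(Real.cosh (L * (z.1 - z.2)))⁻¹| ≤ 1 := fun z => by
    rw [abs_of_pos (inv_pos.2 (Real.cosh_pos _))]
    exact inv_le_one_of_one_le₀ (Real.one_le_cosh _)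
  have hwc : Continuous fun z : ℝ × ℝ => (Real.cosh (L * (z.1 - z.2)))⁻¹ :=
    Continuous.inv₀ (by fun_prop) fun z => (Real.cosh_pos _).ne'
  let E := BoundedContinuousFunction (ℝ × ℝ) (ℝ × ℝ)
  have hlin : ∀ {γ₁ γ₂ : ℝ × ℝ → ℝ}, (∀ z, |γ₁ z| ≤ K) → (∀ z, |γ₂ z| ≤ K) →
      ∀ (y : ℝ × ℝ) (N : ℝ), ‖y‖ ≤ N → ∀ z, |γ₁ z * y.1 + γ₂ z * y.2| ≤ 2 * K * N := by
    intro γ₁ γ₂ b₁ b₂ y N hy z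
    have h1 : |y.1| ≤ N := (norm_fst_le y).trans hy
    have h2 : |y.2| ≤ N := (norm_snd_le y).trans hy
    calc |γ₁ z * y.1 + γ₂ z * y.2| ≤ |γ₁ z * y.1| + |γ₂ z * y.2| := abs_add_le _ _
      _ = |γ₁ z| * |y.1| + |γ₂ z| * |y.2| := by rw [abs_mul, abs_mul]
      _ ≤ K * N + K * N := add_le_add
          (mul_le_mul (b₁ z) h1 (abs_nonneg _) hK) (mul_le_mul (b₂ z) h2 (abs_nonneg _) hK)
      _ = 2 * K * N := by ring
  -- The unknown `u` is `(P, Q)` divided by the weight, hence bounded. The equation for `Q`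
  -- integrates in the second variable; swapping the coordinates in `B` reduces it to the same
  -- Volterra operator.
  let A : E → ℝ × ℝ → ℝ := fun u z => α₁ z * (u z).1 + α₂ z * (u z).2
  let B : E → ℝ × ℝ → ℝ := fun u z => β₁ z.swap * (u z.swap).1 + β₂ z.swap * (u z.swap).2
  have hA : ∀ u, Continuous (A u) := fun u => by fun_prop
  have hB : ∀ u, Continuous (B u) := fun u => by fun_prop
  have bA : ∀ u z, |A u z| ≤ 2 * K * ‖u‖ := fun u z => hlin bα₁ bα₂ _ _ (u.norm_coe_le_norm z) z
  have bB : ∀ u z, |B u z| ≤ 2 * K * ‖u‖ := fun u z =>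
    hlin bβ₁ bβ₂ _ _ (u.norm_coe_le_norm z.swap) z.swap
  have dA : ∀ u v z, |A u z - A v z| ≤ 2 * K * dist u v := fun u v z => by
    have := hlin bα₁ bα₂ (u z - v z) (dist u v)
      (by rw [← dist_eq_norm]; exact BoundedContinuousFunction.dist_coe_le_dist z) z
    refine (congrArg abs ?_).trans_le this
    simp only [A, Prod.fst_sub, Prod.snd_sub]
    ring
  have dB : ∀ u v z, |B u z - B v z| ≤ 2 * K * dist u v := fun u v z => by
    have := hlin bβ₁ bβ₂ (u z.swap - v z.swap) (dist u v)
      (by rw [← dist_eq_norm]; exact BoundedContinuousFunction.dist_coe_le_dist _) z.swap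
    refine (congrArg abs ?_).trans_le this
    simp only [B, Prod.fst_sub, Prod.snd_sub]
    ring
  let T₁ : E → ℝ × ℝ → ℝ := fun u z =>
    (Real.cosh (L * (z.1 - z.2)))⁻¹ + weightedVolterra L (A u) z
  let T₂ : E → ℝ × ℝ → ℝ := fun u z =>
    (Real.cosh (L * (z.1 - z.2)))⁻¹ + weightedVolterra L (B u) z.swap
  have cT₁ : ∀ u, Continuous (T₁ u) := fun u =>
    hwc.add (continuous_weightedVolterra L (hA u))
  have cT₂ : ∀ u, Continuous (T₂ u) := fun u =>
    hwc.add ((continuous_weightedVolterra L (hB u)).comp continuous_swap)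
  let T : E → E := fun u => BoundedContinuousFunction.ofNormedAddCommGroup
    (fun z => (T₁ u z, T₂ u z)) ((cT₁ u).prodMk (cT₂ u)) (1 + 2 * K * ‖u‖ / L) (fun z => by
      refine (norm_prod_le_iff).2 ⟨?_, ?_⟩
      · exact (abs_add_le _ _).trans (add_le_add (hw z) (abs_weightedVolterra_le hL (bA u) z))
      · exact (abs_add_le _ _).trans (add_le_add (hw z) (abs_weightedVolterra_le hL (bB u) _)))
  have hT : ContractingWith (1 / 2 : NNReal) T := by
    refine ⟨by rw [← NNReal.coe_lt_coe]; norm_num, LipschitzWith.of_dist_le_mul fun u v => ?_⟩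
    have key : 2 * K * dist u v / L ≤ 1 / 2 * dist u v := by
      rw [div_le_iff₀ hL, hLdef]
      nlinarith [dist_nonneg (x := u) (y := v)]
    refine (BoundedContinuousFunction.dist_le (by positivity)).2 fun z => ?_
    rw [dist_eq_norm]
    refine (norm_prod_le_iff).2 ⟨?_, ?_⟩
    · change |T₁ u z - T₁ v z| ≤ _
      simp only [T₁, add_sub_add_left_eq_sub]
      rw [weightedVolterra_sub L (hA u) (hA v)]
      exact (abs_weightedVolterra_le hL (dA u v) z).trans (by simpa using key)
    · change |T₂ u z - T₂ v z| ≤ _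
      simp only [T₂, add_sub_add_left_eq_sub]
      rw [weightedVolterra_sub L (hB u) (hB v)]
      exact (abs_weightedVolterra_le hL (dB u v) _).trans (by simpa using key)
  have : Nonempty E := ⟨0⟩
  set u : E := ContractingWith.fixedPoint T hT with hu
  have hfix : T u = u := hT.fixedPoint_isFixedPt
  have h1 : ∀ z, (u z).1 = T₁ u z := fun z => by
    conv_lhs => rw [← hfix]
    rfl
  have h2 : ∀ z, (u z).2 = T₂ u z := fun z => by
    conv_lhs => rw [← hfix]
    rfl
  refine ⟨fun z => (u z).1 * Real.cosh (L * (z.1 - z.2)),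
    fun z => (u z).2 * Real.cosh (L * (z.1 - z.2)), ‖u‖, L, by fun_prop, by fun_prop, ?_, ?_, ?_, ?_⟩
  · intro z
    rw [abs_mul, abs_of_pos (Real.cosh_pos _)]
    exact mul_le_mul_of_nonneg_right ((norm_fst_le _).trans (u.norm_coe_le_norm z))
      (Real.cosh_pos _).le
  · intro z
    rw [abs_mul, abs_of_pos (Real.cosh_pos _)]
    exact mul_le_mul_of_nonneg_right ((norm_snd_le _).trans (u.norm_coe_le_norm z))
      (Real.cosh_pos _).le
  · intro a b
    have hc := (Real.cosh_pos (L * (a - b))).ne'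
    simp only [h1 (a, b), T₁, weightedVolterra, A]
    field_simp
    congr 1
    refine intervalIntegral.integral_congr fun s _ => ?_
    ring
  · intro a b
    have hc := (Real.cosh_pos (L * (a - b))).ne'
    have hc' : ∀ x y, Real.cosh (L * (x - y)) = Real.cosh (L * (y - x)) := fun x y => by
      rw [← Real.cosh_neg]; ring_nf
    simp only [h2 (a, b), T₂, weightedVolterra, B, Prod.swap_prod_mk]
    rw [hc' b a]
    field_simp
    congr 1
    refine intervalIntegral.integral_congr fun s _ => ?_
    rw [hc' s a]
    ring

/-- The solution of the linear Goursat-type system, with its behaviour near the diagonal. -/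
lemma exists_goursat {α₁ α₂ β₁ β₂ : ℝ × ℝ → ℝ} {K : ℝ}
    (hα₁ : Continuous α₁) (hα₂ : Continuous α₂) (hβ₁ : Continuous β₁) (hβ₂ : Continuous β₂)
    (bα₁ : ∀ z, |α₁ z| ≤ K) (bα₂ : ∀ z, |α₂ z| ≤ K)
    (bβ₁ : ∀ z, |β₁ z| ≤ K) (bβ₂ : ∀ z, |β₂ z| ≤ K) :
    ∃ P Q : ℝ × ℝ → ℝ, Continuous P ∧ Continuous Q ∧
      (∀ a b, HasDerivAt (fun s => P (s, b)) (α₁ (a, b) * P (a, b) + α₂ (a, b) * Q (a, b)) a) ∧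
      (∀ a b, HasDerivAt (fun s => Q (a, s)) (β₁ (a, b) * P (a, b) + β₂ (a, b) * Q (a, b)) b) ∧
      (∀ a, P (a, a) = 1) ∧ (∀ a, Q (a, a) = 1) ∧
      ∃ h : ℝ, 0 < h ∧ ∀ z : ℝ × ℝ, |z.1 - z.2| ≤ h →
        P z ∈ Icc (1 / 2 : ℝ) (3 / 2) ∧ Q z ∈ Icc (1 / 2 : ℝ) (3 / 2) := by
  obtain ⟨P, Q, M, L, hP, hQ, bP, bQ, eP, eQ⟩ :=
    exists_goursat_integral hα₁ hα₂ hβ₁ hβ₂ bα₁ bα₂ bβ₁ bβ₂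
  have hK : 0 ≤ K := (abs_nonneg _).trans (bα₁ 0)
  have hM : 0 ≤ M := nonneg_of_mul_nonneg_left ((abs_nonneg _).trans (bP 0)) (Real.cosh_pos _)
  refine ⟨P, Q, hP, hQ, fun a b => ?_, fun a b => ?_, fun a => by simpa using eP a a,
    fun a => by simpa using eQ a a, ?_⟩
  · rw [show (fun s => P (s, b)) = _ from funext fun s => eP s b]
    exact (Continuous.integral_hasStrictDerivAt
      (f := fun s => α₁ (s, b) * P (s, b) + α₂ (s, b) * Q (s, b)) (by fun_prop) b a).hasDerivAt.const_add 1
  · rw [show (fun s => Q (a, s)) = _ from funext fun s => eQ a s]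
    exact (Continuous.integral_hasStrictDerivAt
      (f := fun s => β₁ (a, s) * P (a, s) + β₂ (a, s) * Q (a, s)) (by fun_prop) a b).hasDerivAt.const_add 1
  · set N : ℝ := 2 * K * (M * Real.cosh L) with hN
    have hN0 : 0 ≤ N := by positivity
    have hlin : ∀ {γ₁ γ₂ : ℝ × ℝ → ℝ}, (∀ z, |γ₁ z| ≤ K) → (∀ z, |γ₂ z| ≤ K) →
        ∀ z : ℝ × ℝ, |z.1 - z.2| ≤ 1 → |γ₁ z * P z + γ₂ z * Q z| ≤ N := by
      intro γ₁ γ₂ b₁ b₂ z hz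
      have hc : Real.cosh (L * (z.1 - z.2)) ≤ Real.cosh L := by
        rw [Real.cosh_le_cosh, abs_mul]
        exact mul_le_of_le_one_right (abs_nonneg _) hz
      have h1 : |P z| ≤ M * Real.cosh L := (bP z).trans (mul_le_mul_of_nonneg_left hc hM)
      have h2 : |Q z| ≤ M * Real.cosh L := (bQ z).trans (mul_le_mul_of_nonneg_left hc hM)
      calc |γ₁ z * P z + γ₂ z * Q z| ≤ |γ₁ z * P z| + |γ₂ z * Q z| := abs_add_le _ _
        _ = |γ₁ z| * |P z| + |γ₂ z| * |Q z| := by rw [abs_mul, abs_mul]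
        _ ≤ K * (M * Real.cosh L) + K * (M * Real.cosh L) := add_le_add
            (mul_le_mul (b₁ z) h1 (abs_nonneg _) hK) (mul_le_mul (b₂ z) h2 (abs_nonneg _) hK)
        _ = N := by rw [hN]; ring
    -- This width is at most `1`, where the bound `N` on the integrands is valid, and moves `P` and
    -- `Q` away from `1` by at most `1 / 2`.
    refine ⟨1 / (2 * N + 1), by positivity, ?_⟩
    rintro ⟨a, b⟩ hz
    simp only at hz
    have hz1 : |a - b| ≤ 1 := hz.trans (by rw [div_le_one (by positivity)]; linarith)
    have hNz : N * |a - b| ≤ 1 / 2 := by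
      rw [le_div_iff₀ (by positivity)] at hz
      nlinarith
    have i1 : ‖∫ s in b..a, (α₁ (s, b) * P (s, b) + α₂ (s, b) * Q (s, b))‖ ≤ N * |a - b| := by
      refine intervalIntegral.norm_integral_le_of_norm_le_const fun s hs => hlin bα₁ bα₂ _ ?_
      exact (abs_sub_left_of_mem_uIcc (uIoc_subset_uIcc hs)).trans hz1
    have i2 : ‖∫ s in a..b, (β₁ (a, s) * P (a, s) + β₂ (a, s) * Q (a, s))‖ ≤ N * |b - a| := by
      refine intervalIntegral.norm_integral_le_of_norm_le_const fun s hs => hlin bβ₁ bβ₂ _ ?_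
      rw [abs_sub_comm] at hz1
      rw [abs_sub_comm]
      exact (abs_sub_left_of_mem_uIcc (uIoc_subset_uIcc hs)).trans hz1
    rw [abs_sub_comm b a] at i2
    rw [Real.norm_eq_abs] at i1 i2
    have j1 := abs_le.1 (i1.trans hNz)
    have j2 := abs_le.1 (i2.trans hNz)
    rw [eP, eQ]
    constructor <;> constructor <;> linarith

/-! ### Inverting the change of variables near the diagonal -/

lemma exists_continuousLinearEquiv_prod {A B C D : ℝ} (h : A * D - B * C ≠ 0) :
    ∃ e : (ℝ × ℝ) ≃L[ℝ] (ℝ × ℝ), (e : (ℝ × ℝ) →L[ℝ] (ℝ × ℝ)) =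
      (A • ContinuousLinearMap.fst ℝ ℝ ℝ + B • ContinuousLinearMap.snd ℝ ℝ ℝ).prod
        (C • ContinuousLinearMap.fst ℝ ℝ ℝ + D • ContinuousLinearMap.snd ℝ ℝ ℝ) := by
  refine ⟨ContinuousLinearEquiv.equivOfInverse
    ((A • ContinuousLinearMap.fst ℝ ℝ ℝ + B • ContinuousLinearMap.snd ℝ ℝ ℝ).prod
      (C • ContinuousLinearMap.fst ℝ ℝ ℝ + D • ContinuousLinearMap.snd ℝ ℝ ℝ))
    (((A * D - B * C)⁻¹ • (D • ContinuousLinearMap.fst ℝ ℝ ℝ -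
        B • ContinuousLinearMap.snd ℝ ℝ ℝ)).prod
      ((A * D - B * C)⁻¹ • (A • ContinuousLinearMap.snd ℝ ℝ ℝ -
        C • ContinuousLinearMap.fst ℝ ℝ ℝ))) ?_ ?_, rfl⟩
  · rintro ⟨x, y⟩
    simp only [ContinuousLinearMap.prod_apply, add_apply,
      sub_apply, smul_apply, ContinuousLinearMap.coe_fst',
      ContinuousLinearMap.coe_snd', smul_eq_mul, Prod.mk.injEq]
    constructor
    · rw [inv_mul_eq_iff_eq_mul₀ h]; ring
    · rw [inv_mul_eq_iff_eq_mul₀ h]; ring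
  · rintro ⟨x, y⟩
    simp only [ContinuousLinearMap.prod_apply, add_apply,
      sub_apply, smul_apply, ContinuousLinearMap.coe_fst',
      ContinuousLinearMap.coe_snd', smul_eq_mul, Prod.mk.injEq]
    constructor
    · calc _ = (A * D - B * C)⁻¹ * ((A * D - B * C) * x) := by ring
        _ = x := inv_mul_cancel_left₀ h x
    · calc _ = (A * D - B * C)⁻¹ * ((A * D - B * C) * y) := by ring
        _ = y := inv_mul_cancel_left₀ h y

/-- A right inverse of a `C¹` map that is injective on an open set containing the values of the
right inverse is `C¹` wherever the derivative is invertible. -/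
lemma contDiffAt_of_rightInverse_of_injOn {E F : Type*} [NormedAddCommGroup E] [NormedSpace ℝ E]
    [NormedAddCommGroup F] [NormedSpace ℝ F] [CompleteSpace E] {Φ : E → F} {Ψ : F → E}
    {S : Set E} {U : Set F} (hS : IsOpen S) (hU : IsOpen U) (hΦ : ContDiff ℝ 1 Φ)
    (hinj : InjOn Φ S) (hmaps : MapsTo Ψ U S) (hright : ∀ y ∈ U, Φ (Ψ y) = y)
    {y : F} (hy : y ∈ U) {e : E ≃L[ℝ] F} (he : HasFDerivAt Φ (e : E →L[ℝ] F) (Ψ y)) :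
    ContDiffAt ℝ 1 Ψ y := by
  have hs : HasStrictFDerivAt Φ (e : E →L[ℝ] F) (Ψ y) :=
    hΦ.contDiffAt.hasStrictFDerivAt' he one_ne_zero
  have h1 := hΦ.contDiffAt.to_localInverse he one_ne_zero
  rw [hright y hy] at h1
  refine h1.congr_of_eventuallyEq ?_
  have h2 := hs.eventually_right_inverse
  -- The local inverse stays in `S` near `y`, so injectivity on `S` forces it to agree with `Ψ`.
  have h3 : ∀ᶠ x in 𝓝 (Φ (Ψ y)), hs.localInverse Φ e (Ψ y) x ∈ S :=
    hs.localInverse_tendsto.eventually (hS.mem_nhds (hmaps hy))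
  rw [hright y hy] at h2 h3
  filter_upwards [h2, h3, hU.mem_nhds hy] with x hx2 hx3 hxU
  exact hinj (hmaps hxU) hx3 ((hright x hxU).trans hx2.symm)

/-- A global inverse on a space-time strip for a change of variables `(a, b) ↦ (t, x)` that is the
identity on the diagonal, with `t` decreasing in `a` and increasing in `b`, and with `x`
increasing in both variables. -/
lemma exists_inverse_near_diagonal {t x tA tB xA xB : ℝ × ℝ → ℝ} {h δ N : ℝ}
    (hh : 0 < h) (hδ : 0 < δ)
    (ht : ∀ z, HasFDerivAt t (tA z • ContinuousLinearMap.fst ℝ ℝ ℝ +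
      tB z • ContinuousLinearMap.snd ℝ ℝ ℝ) z)
    (hx : ∀ z, HasFDerivAt x (xA z • ContinuousLinearMap.fst ℝ ℝ ℝ +
      xB z • ContinuousLinearMap.snd ℝ ℝ ℝ) z)
    (ht0 : ∀ a, t (a, a) = 0) (hx0 : ∀ a, x (a, a) = a)
    (htA : ∀ z : ℝ × ℝ, |z.1 - z.2| ≤ h → tA z ≤ -δ)
    (htB : ∀ z : ℝ × ℝ, |z.1 - z.2| ≤ h → δ ≤ tB z)
    (hxA : ∀ z : ℝ × ℝ, |z.1 - z.2| ≤ h → 0 < xA z)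
    (hxB : ∀ z : ℝ × ℝ, |z.1 - z.2| ≤ h → 0 < xB z ∧ xB z ≤ N) :
    InjOn (fun z => (t z, x z)) {z : ℝ × ℝ | |z.1 - z.2| < h} ∧
    ∃ Ψ : ℝ × ℝ → ℝ × ℝ, ∀ y : ℝ × ℝ, |y.1| < δ * h →
      |(Ψ y).1 - (Ψ y).2| < h ∧ (t (Ψ y), x (Ψ y)) = y := by
  have hconv : Convex ℝ {z : ℝ × ℝ | |z.1 - z.2| ≤ h} := by
    have : {z : ℝ × ℝ | |z.1 - z.2| ≤ h} =
        (ContinuousLinearMap.fst ℝ ℝ ℝ - ContinuousLinearMap.snd ℝ ℝ ℝ) ⁻¹' Icc (-h) h := by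
      ext z; simp [abs_le]
    rw [this]
    exact (convex_Icc _ _).linear_preimage _
  have mvt : ∀ {F A B : ℝ × ℝ → ℝ}, (∀ z, HasFDerivAt F (A z • ContinuousLinearMap.fst ℝ ℝ ℝ +
      B z • ContinuousLinearMap.snd ℝ ℝ ℝ) z) → ∀ {z z' : ℝ × ℝ}, |z.1 - z.2| ≤ h →
      |z'.1 - z'.2| ≤ h → ∃ w : ℝ × ℝ, |w.1 - w.2| ≤ h ∧
        F z' - F z = A w * (z'.1 - z.1) + B w * (z'.2 - z.2) := by
    intro F A B hF z z' hz hz'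
    obtain ⟨w, hw, hw'⟩ := domain_mvt (s := {z : ℝ × ℝ | |z.1 - z.2| ≤ h})
      (fun z _ => (hF z).hasFDerivWithinAt) hconv hz hz'
    exact ⟨w, hconv.segment_subset hz hz' hw, by simpa using hw'⟩
  have T1 : ∀ {z z' : ℝ × ℝ}, |z.1 - z.2| ≤ h → |z'.1 - z'.2| ≤ h → z'.1 ≤ z.1 → z.2 ≤ z'.2 →
      δ * ((z.1 - z'.1) + (z'.2 - z.2)) ≤ t z' - t z := by
    intro z z' hz hz' h1 h2
    obtain ⟨w, hw, e⟩ := mvt ht hz hz'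
    rw [e]
    nlinarith [mul_le_mul_of_nonneg_right (htA w hw) (sub_nonneg.2 h1),
      mul_le_mul_of_nonneg_right (htB w hw) (sub_nonneg.2 h2)]
  have X1 : ∀ {z z' : ℝ × ℝ}, |z.1 - z.2| ≤ h → |z'.1 - z'.2| ≤ h → z.1 ≤ z'.1 → z.2 ≤ z'.2 →
      x z = x z' → z = z' := by
    intro z z' hz hz' h1 h2 he
    obtain ⟨w, hw, e⟩ := mvt hx hz hz'
    rw [he, sub_self] at e
    have e1 : 0 ≤ xA w * (z'.1 - z.1) := mul_nonneg (hxA w hw).le (sub_nonneg.2 h1)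
    have e2 : 0 ≤ xB w * (z'.2 - z.2) := mul_nonneg (hxB w hw).1.le (sub_nonneg.2 h2)
    have e3 : xA w * (z'.1 - z.1) = 0 := by linarith
    have e4 : xB w * (z'.2 - z.2) = 0 := by linarith
    rw [mul_eq_zero_iff_left (hxA w hw).ne'] at e3
    rw [mul_eq_zero_iff_left (hxB w hw).1.ne'] at e4
    exact Prod.ext (by linarith) (by linarith)
  have T2 : ∀ {z z' : ℝ × ℝ}, |z.1 - z.2| ≤ h → |z'.1 - z'.2| ≤ h → z'.1 ≤ z.1 → z.2 ≤ z'.2 →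
      t z = t z' → z = z' := by
    intro z z' hz hz' h1 h2 he
    have := T1 hz hz' h1 h2
    rw [he, sub_self] at this
    have h3 : (z.1 - z'.1) + (z'.2 - z.2) ≤ 0 := nonpos_of_mul_nonpos_right this hδ
    exact Prod.ext (by linarith) (by linarith)
  -- Two points are comparable either in the product order, where `x` separates them, or in the
  -- order with one coordinate reversed, where `t` does.
  have hinj : ∀ z z' : ℝ × ℝ, |z.1 - z.2| ≤ h → |z'.1 - z'.2| ≤ h → t z = t z' → x z = x z' →
      z = z' := by
    intro z z' hz hz' e1 e2
    rcases le_total z.1 z'.1 with h1 | h1 <;> rcases le_total z.2 z'.2 with h2 | h2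
    · exact X1 hz hz' h1 h2 e2
    · exact (T2 hz' hz h1 h2 e1.symm).symm
    · exact T2 hz hz' h1 h2 e1
    · exact (X1 hz' hz h1 h2 e2.symm).symm
  refine ⟨fun z hz z' hz' e => hinj z z' (le_of_lt hz) (le_of_lt hz')
    (congrArg Prod.fst e) (congrArg Prod.snd e), ?_⟩
  have htc : Continuous t := continuous_iff_continuousAt.2 fun z => (ht z).continuousAt
  have hxc : Continuous x := continuous_iff_continuousAt.2 fun z => (hx z).continuousAt
  suffices H : ∀ y : ℝ × ℝ, |y.1| < δ * h →
      ∃ z : ℝ × ℝ, |z.1 - z.2| < h ∧ (t z, x z) = y by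
    classical
    refine ⟨fun y => if hy : |y.1| < δ * h then (H y hy).choose else 0, fun y hy => ?_⟩
    simp only [dif_pos hy]
    exact (H y hy).choose_spec
  rintro ⟨τ, ξ⟩ hτ
  simp only at hτ
  obtain ⟨hτ1, hτ2⟩ := abs_lt.1 hτ
  have hd : ∀ a : ℝ, |a - a| ≤ h := fun a => by simpa using hh.le
  -- For surjectivity, the level set `t = τ` is exhibited as the graph of a function `B`. Moving `b`
  -- by `h` off the diagonal changes `t` by at least `δ * h > |τ|`.
  have hB : ∀ a, ∃ b, |a - b| ≤ h ∧ t (a, b) = τ := by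
    intro a
    have h1 : |a - (a - h)| ≤ h := by simp [abs_of_pos hh]
    have h2 : |a - (a + h)| ≤ h := by simp [abs_of_pos hh]
    have l1 := T1 (z := (a, a - h)) (z' := (a, a)) h1 (hd a) le_rfl (by simpa using hh.le)
    have l2 := T1 (z := (a, a)) (z' := (a, a + h)) (hd a) h2 le_rfl (by simpa using hh.le)
    simp only [ht0, sub_self, zero_add, sub_sub_cancel, add_sub_cancel_left] at l1 l2
    obtain ⟨b, hb, e⟩ := intermediate_value_Icc (f := fun b => t (a, b))
      (by linarith : a - h ≤ a + h) (by fun_prop)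
      (show τ ∈ Icc (t (a, a - h)) (t (a, a + h)) from ⟨by linarith, by linarith⟩)
    exact ⟨b, abs_le.2 ⟨by linarith [hb.2], by linarith [hb.1]⟩, e⟩
  have hA : ∀ b, ∃ a, |a - b| ≤ h ∧ t (a, b) = τ := by
    intro b
    have h1 : |(b - h) - b| ≤ h := by simp [abs_of_pos hh]
    have h2 : |(b + h) - b| ≤ h := by simp [abs_of_pos hh]
    have l1 := T1 (z := (b + h, b)) (z' := (b, b)) h2 (hd b) (by simpa using hh.le) le_rfl
    have l2 := T1 (z := (b, b)) (z' := (b - h, b)) (hd b) h1 (by simpa using hh.le) le_rfl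
    simp only [ht0, sub_self, add_zero, sub_sub_cancel, add_sub_cancel_left] at l1 l2
    obtain ⟨a, ha, e⟩ := intermediate_value_Icc' (f := fun a => t (a, b))
      (by linarith : b - h ≤ b + h) (by fun_prop)
      (show τ ∈ Icc (t (b + h, b)) (t (b - h, b)) from ⟨by linarith, by linarith⟩)
    exact ⟨a, abs_le.2 ⟨by linarith [ha.1], by linarith [ha.2]⟩, e⟩
  choose B hB1 hB2 using hB
  have hmono : StrictMono B := by
    intro a a' haa
    by_contra! hle
    have := T2 (z := (a', B a')) (z' := (a, B a)) (hB1 a') (hB1 a) haa.le hle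
      (by rw [hB2, hB2])
    exact haa.ne' (congrArg Prod.fst this)
  -- Surjectivity is wanted for continuity: a monotone surjection of the line is continuous.
  have hsurj : Function.Surjective B := by
    intro b
    obtain ⟨a, ha1, ha2⟩ := hA b
    refine ⟨a, ?_⟩
    rcases le_total (B a) b with hle | hle
    · exact congrArg Prod.snd (T2 (z := (a, B a)) (z' := (a, b)) (hB1 a) ha1 le_rfl hle
        (by rw [hB2, ha2]))
    · exact (congrArg Prod.snd (T2 (z := (a, b)) (z' := (a, B a)) ha1 (hB1 a) le_rfl hle
        (by rw [hB2, ha2]))).symm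
  have hBc : Continuous B := hmono.monotone.continuous_of_surjective hsurj
  -- Along the graph `x` stays within `N * h` of `a`, so it takes every value.
  have hclose : ∀ a, |x (a, B a) - a| ≤ N * h := by
    intro a
    obtain ⟨w, hw, e⟩ := mvt hx (z := (a, a)) (z' := (a, B a)) (hd a) (hB1 a)
    simp only [hx0, sub_self, mul_zero, zero_add] at e
    rw [e, abs_mul, abs_of_pos (hxB w hw).1, abs_sub_comm]
    exact mul_le_mul (hxB w hw).2 (hB1 a) (abs_nonneg _) ((hxB w hw).1.le.trans (hxB w hw).2)
  obtain ⟨a, ha⟩ := mem_range_of_exists_le_of_exists_ge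
    (f := fun a => x (a, B a)) (c := ξ) (by fun_prop)
    ⟨ξ - N * h, by linarith [(abs_le.1 (hclose (ξ - N * h))).2]⟩
    ⟨ξ + N * h, by linarith [(abs_le.1 (hclose (ξ + N * h))).1]⟩
  refine ⟨(a, B a), ?_, Prod.ext (hB2 a) ha⟩
  have h3 : δ * |a - B a| ≤ |τ| := by
    rcases le_total a (B a) with hle | hle
    · have := T1 (z := (a, a)) (z' := (a, B a)) (hd a) (hB1 a) le_rfl hle
      simp only [ht0, hB2, sub_self, zero_add, sub_zero] at this
      rw [abs_of_nonpos (sub_nonpos.2 hle), neg_sub]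
      exact this.trans (le_abs_self _)
    · have := T1 (z := (a, B a)) (z' := (a, a)) (hB1 a) (hd a) le_rfl hle
      simp only [ht0, hB2, sub_self, zero_add, zero_sub] at this
      rw [abs_of_nonneg (sub_nonneg.2 hle)]
      exact this.trans (neg_le_abs _)
  exact lt_of_mul_lt_mul_left (h3.trans_lt hτ) hδ.le

/-! ### Characteristic coordinates and existence for the diagonal system -/

/-- All four Goursat coefficients have this shape up to sign. As `u / (u + v) ≤ 1`, no upper bound
on `u` or `v` is needed; this matters for `γ = 3`, where the invariants may be unbounded. -/
lemma abs_mul_mul_div_le {k d u v C c : ℝ} (hk0 : 0 ≤ k) (hk1 : k ≤ 1) (hd : |d| ≤ C) (hu : 0 < u)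
    (hc : 0 < c) (hv : c ≤ v) : |k * d * (u / (v * (u + v)))| ≤ C / c := by
  have hC : 0 ≤ C := (abs_nonneg _).trans hd
  have hv0 : 0 < v := hc.trans_le hv
  have h1 : u / (v * (u + v)) ≤ 1 / c := by
    rw [div_le_div_iff₀ (by positivity) hc]
    nlinarith [mul_le_mul_of_nonneg_left hv hu.le, mul_pos hv0 hv0]
  have h2 : |k * d| ≤ C := by
    rw [abs_mul, abs_of_nonneg hk0]
    exact (mul_le_of_le_one_left (abs_nonneg _) hk1).trans hd
  rw [abs_mul, abs_of_pos (a := u / _) (by positivity), div_eq_mul_one_div C c]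
  exact mul_le_mul h2 h1 (by positivity) hC

/-- Characteristic coordinates for the diagonal system with speeds `1 / (k₁ W + k₂ Z)` and
`1 / (k₂ W + k₁ Z)`: the time `t (a, b)` and the place `x (a, b)` at which the first characteristic
from `a` meets the second characteristic from `b`. -/
lemma exists_characteristic_coordinates {f g : ℝ → ℝ} {k₁ k₂ c C : ℝ} (hf : ContDiff ℝ 1 f)
    (hg : ContDiff ℝ 1 g) (hfC : ∀ x, |deriv f x| ≤ C) (hgC : ∀ x, |deriv g x| ≤ C)
    (hk₁ : 0 ≤ k₁) (hk₂ : 0 ≤ k₂) (hk : k₁ + k₂ = 1) (hc : 0 < c) {l m : ℝ × ℝ → ℝ}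
    (hl : ∀ z, l z = k₁ * f z.1 + k₂ * g z.2) (hm : ∀ z, m z = -(k₂ * f z.1 + k₁ * g z.2))
    (hlc : ∀ z, c ≤ l z) (hmc : ∀ z, c ≤ m z) :
    ∃ (P Q t x : ℝ × ℝ → ℝ) (h : ℝ), 0 < h ∧ ContDiff ℝ 1 t ∧ ContDiff ℝ 1 x ∧
      (∀ z, HasFDerivAt t ((-(Q z * (l z * m z / (l z + m z)))) • ContinuousLinearMap.fst ℝ ℝ ℝ +
        (P z * (l z * m z / (l z + m z))) • ContinuousLinearMap.snd ℝ ℝ ℝ) z) ∧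
      (∀ z, HasFDerivAt x ((Q z * (l z / (l z + m z))) • ContinuousLinearMap.fst ℝ ℝ ℝ +
        (P z * (m z / (l z + m z))) • ContinuousLinearMap.snd ℝ ℝ ℝ) z) ∧
      (∀ a, t (a, a) = 0) ∧ (∀ a, x (a, a) = a) ∧
      ∀ z : ℝ × ℝ, |z.1 - z.2| ≤ h →
        P z ∈ Icc (1 / 2 : ℝ) (3 / 2) ∧ Q z ∈ Icc (1 / 2 : ℝ) (3 / 2) := by
  have hk₁' : k₁ ≤ 1 := by linarith
  have hk₂' : k₂ ≤ 1 := by linarith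
  have hl0 : ∀ z, 0 < l z := fun z => hc.trans_le (hlc z)
  have hm0 : ∀ z, 0 < m z := fun z => hc.trans_le (hmc z)
  have hlm0 : ∀ z, l z + m z ≠ 0 := fun z => (add_pos (hl0 z) (hm0 z)).ne'
  have hfd : ∀ a, HasDerivAt f (deriv f a) a :=
    fun a => (hf.differentiable one_ne_zero).differentiableAt.hasDerivAt
  have hgd : ∀ a, HasDerivAt g (deriv g a) a :=
    fun a => (hg.differentiable one_ne_zero).differentiableAt.hasDerivAt
  have hf' : Continuous (deriv f) := hf.continuous_deriv le_rfl
  have hg' : Continuous (deriv g) := hg.continuous_deriv le_rfl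
  have hfc := hf.continuous
  have hgc := hg.continuous
  have hlcont : Continuous l := by rw [funext hl]; fun_prop
  have hmcont : Continuous m := by rw [funext hm]; fun_prop
  have lA : ∀ a b, HasDerivAt (fun s => l (s, b)) (k₁ * deriv f a) a := fun a b => by
    simp only [hl]; exact ((hfd a).const_mul k₁).add_const _
  have lB : ∀ a b, HasDerivAt (fun s => l (a, s)) (k₂ * deriv g b) b := fun a b => by
    simp only [hl]; exact ((hgd b).const_mul k₂).const_add _
  have mA : ∀ a b, HasDerivAt (fun s => m (s, b)) (-(k₂ * deriv f a)) a := fun a b => by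
    simp only [hm]; exact (((hfd a).const_mul k₂).add_const _).neg
  have mB : ∀ a b, HasDerivAt (fun s => m (a, s)) (-(k₁ * deriv g b)) b := fun a b => by
    simp only [hm]; exact (((hgd b).const_mul k₁).const_add _).neg
  have hml0 : ∀ z, m z * (l z + m z) ≠ 0 := fun z => mul_ne_zero (hm0 z).ne' (hlm0 z)
  have hll0 : ∀ z, l z * (m z + l z) ≠ 0 := fun z =>
    mul_ne_zero (hl0 z).ne' (add_pos (hm0 z) (hl0 z)).ne'
  have hneg : ∀ r C : ℝ, |r| ≤ C → |-r| ≤ C := fun r C h => by rwa [abs_neg]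
  -- From `t_b = l x_b` and `t_a = -m x_a` one gets `(l + m) x_ab = -(l_a x_b + m_b x_a)`.
  -- Substituting `x_b = P m / (l + m)` and `x_a = Q l / (l + m)` gives these coefficients, which
  -- contain no second derivatives of `f` and `g`. The initial line `t = 0`, `x = a` corresponds to
  -- `P = Q = 1` on the diagonal.
  obtain ⟨P, Q, hP, hQ, dP, dQ, P1, Q1, h, hh, hPQ⟩ := exists_goursat (K := C / c)
    (α₁ := fun z => k₂ * deriv f z.1 * (l z / (m z * (l z + m z))))
    (α₂ := fun z => k₁ * deriv g z.2 * (l z / (m z * (l z + m z))))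
    (β₁ := fun z => -(k₁ * deriv f z.1 * (m z / (l z * (m z + l z)))))
    (β₂ := fun z => -(k₂ * deriv g z.2 * (m z / (l z * (m z + l z)))))
    (by fun_prop (disch := assumption)) (by fun_prop (disch := assumption))
    (by fun_prop (disch := assumption)) (by fun_prop (disch := assumption))
    (fun z => abs_mul_mul_div_le hk₂ hk₂' (hfC _) (hl0 z) hc (hmc z))
    (fun z => abs_mul_mul_div_le hk₁ hk₁' (hgC _) (hl0 z) hc (hmc z))
    (fun z => hneg _ _ (abs_mul_mul_div_le hk₁ hk₁' (hfC _) (hm0 z) hc (hlc z)))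
    (fun z => hneg _ _ (abs_mul_mul_div_le hk₂ hk₂' (hgC _) (hm0 z) hc (hlc z)))
  have hsq0 : ∀ z, (l z + m z) ^ 2 ≠ 0 := fun z => pow_ne_zero 2 (hlm0 z)
  obtain ⟨t, ht1, ht2, ht3⟩ := exists_potential
    (p := fun a b => P (a, b) * (l (a, b) * m (a, b) / (l (a, b) + m (a, b))))
    (q := fun a b => -(Q (a, b) * (l (a, b) * m (a, b) / (l (a, b) + m (a, b)))))
    (r := fun a b => k₁ * (P (a, b) * deriv f a * m (a, b) ^ 2 + Q (a, b) * deriv g b * l (a, b) ^ 2)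
      / (l (a, b) + m (a, b)) ^ 2) (φ := fun _ => 0)
    (by
      change Continuous fun z : ℝ × ℝ => P z * (l z * m z / (l z + m z))
      fun_prop (disch := assumption))
    (by
      change Continuous fun z : ℝ × ℝ => -(Q z * (l z * m z / (l z + m z)))
      fun_prop (disch := assumption))
    (by
      change Continuous fun z : ℝ × ℝ => k₁ * (P z * deriv f z.1 * m z ^ 2 +
        Q z * deriv g z.2 * l z ^ 2) / (l z + m z) ^ 2
      fun_prop (disch := assumption))
    (fun a b => by
      have := (dP a b).mul (((lA a b).mul (mA a b)).div ((lA a b).add (mA a b)) (hlm0 (a, b)))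
      refine this.congr_deriv ?_
      have h1 := hlm0 (a, b)
      have h2 := (hm0 (a, b)).ne'
      simp only [Pi.mul_apply, Pi.add_apply, Pi.div_apply]
      field_simp
      ring)
    (fun a b => by
      have := ((dQ a b).mul (((lB a b).mul (mB a b)).div ((lB a b).add (mB a b)) (hlm0 (a, b)))).neg
      refine this.congr_deriv ?_
      have h1 := hlm0 (a, b)
      have h1' : m (a, b) + l (a, b) ≠ 0 := by rwa [add_comm]
      have h2 := (hl0 (a, b)).ne'
      simp only [Pi.mul_apply, Pi.add_apply, Pi.div_apply]
      rw [add_comm (m (a, b)) (l (a, b))]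
      field_simp
      ring)
    (fun a => by simpa [P1, Q1] using hasDerivAt_const a (0 : ℝ))
  obtain ⟨x, hx1, hx2, hx3⟩ := exists_potential
    (p := fun a b => P (a, b) * (m (a, b) / (l (a, b) + m (a, b))))
    (q := fun a b => Q (a, b) * (l (a, b) / (l (a, b) + m (a, b))))
    (r := fun a b => k₁ * (Q (a, b) * deriv g b * l (a, b) - P (a, b) * deriv f a * m (a, b))
      / (l (a, b) + m (a, b)) ^ 2) (φ := fun a => a)
    (by
      change Continuous fun z : ℝ × ℝ => P z * (m z / (l z + m z))
      fun_prop (disch := assumption))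
    (by
      change Continuous fun z : ℝ × ℝ => Q z * (l z / (l z + m z))
      fun_prop (disch := assumption))
    (by
      change Continuous fun z : ℝ × ℝ => k₁ * (Q z * deriv g z.2 * l z -
        P z * deriv f z.1 * m z) / (l z + m z) ^ 2
      fun_prop (disch := assumption))
    (fun a b => by
      have := (dP a b).mul ((mA a b).div ((lA a b).add (mA a b)) (hlm0 (a, b)))
      refine this.congr_deriv ?_
      have h1 := hlm0 (a, b)
      have h2 := (hm0 (a, b)).ne'
      simp only [Pi.add_apply, Pi.div_apply]
      field_simp
      ring)
    (fun a b => by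
      have := (dQ a b).mul ((lB a b).div ((lB a b).add (mB a b)) (hlm0 (a, b)))
      refine this.congr_deriv ?_
      have h1 := hlm0 (a, b)
      have h2 := (hl0 (a, b)).ne'
      simp only [Pi.add_apply, Pi.div_apply]
      rw [add_comm (m (a, b)) (l (a, b))]
      field_simp
      ring)
    (fun a => by
      refine (hasDerivAt_id a).congr_deriv ?_
      have h1 := hlm0 (a, a)
      simp only [P1, Q1, one_mul]
      field_simp
      ring)
  exact ⟨P, Q, t, x, h, hh, ht1, hx1, ht2, hx2, ht3, hx3, hPQ⟩

/-- Local existence for the diagonal system `W_t + W_x / (k₁ W + k₂ Z) = 0`,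
`Z_t + Z_x / (k₂ W + k₁ Z) = 0`, where the first speed is positive and the second negative. -/
lemma exists_diagonal_solution {f g : ℝ → ℝ} {k₁ k₂ c C : ℝ} (hf : ContDiff ℝ 1 f)
    (hg : ContDiff ℝ 1 g) (hfC : ∀ x, |deriv f x| ≤ C) (hgC : ∀ x, |deriv g x| ≤ C)
    (hk₁ : 0 ≤ k₁) (hk₂ : 0 ≤ k₂) (hk : k₁ + k₂ = 1) (hc : 0 < c)
    (hl : ∀ a b, c ≤ k₁ * f a + k₂ * g b) (hm : ∀ a b, k₂ * f a + k₁ * g b ≤ -c) :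
    ∃ T : ℝ, 0 < T ∧ ∃ W Z : ℝ × ℝ → ℝ, (∀ x, W (0, x) = f x) ∧ (∀ x, Z (0, x) = g x) ∧
      ∀ y : ℝ × ℝ, |y.1| < T → ContDiffAt ℝ 1 W y ∧ ContDiffAt ℝ 1 Z y ∧
        W y ∈ range f ∧ Z y ∈ range g ∧
        (∃ d, |d| ≤ 2 * C ∧ HasFDerivAt W (d • (ContinuousLinearMap.snd ℝ ℝ ℝ -
          (k₁ * W y + k₂ * Z y)⁻¹ • ContinuousLinearMap.fst ℝ ℝ ℝ)) y) ∧
        ∃ d, |d| ≤ 2 * C ∧ HasFDerivAt Z (d • (ContinuousLinearMap.snd ℝ ℝ ℝ -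
          (k₂ * W y + k₁ * Z y)⁻¹ • ContinuousLinearMap.fst ℝ ℝ ℝ)) y := by
  set l : ℝ × ℝ → ℝ := fun z => k₁ * f z.1 + k₂ * g z.2 with hldef
  set m : ℝ × ℝ → ℝ := fun z => -(k₂ * f z.1 + k₁ * g z.2) with hmdef
  have hlc : ∀ z, c ≤ l z := fun z => hl _ _
  have hmc : ∀ z, c ≤ m z := fun z => by have := hm z.1 z.2; simp only [hmdef]; linarith
  have hl0 : ∀ z, 0 < l z := fun z => hc.trans_le (hlc z)
  have hm0 : ∀ z, 0 < m z := fun z => hc.trans_le (hmc z)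
  obtain ⟨P, Q, t, x, h, hh, ht1, hx1, ht2, hx2, ht3, hx3, hPQ⟩ :=
    exists_characteristic_coordinates hf hg hfC hgC hk₁ hk₂ hk hc
      (l := l) (m := m) (fun _ => rfl) (fun _ => rfl) hlc hmc
  have hlm : ∀ z, c / 2 ≤ l z * m z / (l z + m z) := fun z => by
    rw [le_div_iff₀ (add_pos (hl0 z) (hm0 z))]
    nlinarith [mul_le_mul_of_nonneg_left (hlc z) (hm0 z).le,
      mul_le_mul_of_nonneg_left (hmc z) (hl0 z).le]
  have hfrac : ∀ z, 0 < m z / (l z + m z) ∧ m z / (l z + m z) ≤ 1 := fun z => by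
    have h1 := hl0 z
    have h2 := hm0 z
    exact ⟨by positivity, by rw [div_le_one (by positivity)]; linarith⟩
  -- With `P, Q ≥ 1 / 2` and `l m / (l + m) ≥ c / 2`, the time derivatives are at least `c / 4` in
  -- absolute value; `N` comes from `P ≤ 3 / 2`.
  obtain ⟨hinj, Ψ, hΨ⟩ := exists_inverse_near_diagonal (h := h) (δ := c / 4) (N := 3 / 2) hh
    (by positivity) ht2 hx2 ht3 hx3
    (fun z hz => by
      have h1 := (hPQ z hz).2.1
      nlinarith [mul_le_mul h1 (hlm z) (by positivity) (by linarith)])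
    (fun z hz => by
      have h1 := (hPQ z hz).1.1
      nlinarith [mul_le_mul h1 (hlm z) (by positivity) (by linarith)])
    (fun z hz => by
      have h1 := (hPQ z hz).2.1
      have h2 := hl0 z
      have h3 := hm0 z
      have : 0 < Q z := by linarith
      positivity)
    (fun z hz => by
      have h1 := (hPQ z hz).1
      refine ⟨mul_pos (by linarith [h1.1]) (hfrac z).1, ?_⟩
      calc P z * (m z / (l z + m z)) ≤ 3 / 2 * 1 :=
            mul_le_mul h1.2 (hfrac z).2 (hfrac z).1.le (by norm_num)
        _ = 3 / 2 := by norm_num)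
  have hT : 0 < c / 4 * h := by positivity
  have hS : IsOpen {z : ℝ × ℝ | |z.1 - z.2| < h} := isOpen_lt (by fun_prop) (by fun_prop)
  have hU : IsOpen {y : ℝ × ℝ | |y.1| < c / 4 * h} := isOpen_lt (by fun_prop) (by fun_prop)
  have hΨ0 : ∀ x, Ψ (0, x) = (x, x) := fun ξ => by
    have h1 := hΨ (0, ξ) (by simpa using hT)
    refine hinj h1.1 (by simpa using hh) ?_
    simp only [h1.2, ht3, hx3]
  refine ⟨c / 4 * h, hT, fun y => f (Ψ y).1, fun y => g (Ψ y).2, fun x => by simp [hΨ0],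
    fun x => by simp [hΨ0], fun y hy => ?_⟩
  obtain ⟨hΨs, -⟩ := hΨ y hy
  obtain ⟨⟨hP1, -⟩, hQ1, -⟩ := hPQ (Ψ y) hΨs.le
  have hP0 : 0 < P (Ψ y) := by linarith
  have hQ0 : 0 < Q (Ψ y) := by linarith
  have hlz := hl0 (Ψ y)
  have hmz := hm0 (Ψ y)
  have hlmz := (add_pos hlz hmz).ne'
  have hdet : -(Q (Ψ y) * (l (Ψ y) * m (Ψ y) / (l (Ψ y) + m (Ψ y)))) *
      (P (Ψ y) * (m (Ψ y) / (l (Ψ y) + m (Ψ y)))) -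
      P (Ψ y) * (l (Ψ y) * m (Ψ y) / (l (Ψ y) + m (Ψ y))) *
      (Q (Ψ y) * (l (Ψ y) / (l (Ψ y) + m (Ψ y)))) ≠ 0 := by
    refine ne_of_lt ?_
    have e1 : 0 < Q (Ψ y) * (l (Ψ y) * m (Ψ y) / (l (Ψ y) + m (Ψ y))) *
      (P (Ψ y) * (m (Ψ y) / (l (Ψ y) + m (Ψ y)))) := by positivity
    have e2 : 0 < P (Ψ y) * (l (Ψ y) * m (Ψ y) / (l (Ψ y) + m (Ψ y))) *
      (Q (Ψ y) * (l (Ψ y) / (l (Ψ y) + m (Ψ y)))) := by positivity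
    linarith
  obtain ⟨e, he⟩ := exists_continuousLinearEquiv_prod hdet
  have hΦ : HasFDerivAt (fun z => (t z, x z)) (e : (ℝ × ℝ) →L[ℝ] (ℝ × ℝ)) (Ψ y) := by
    rw [he]
    exact (ht2 _).prodMk (hx2 _)
  have hΨc : ContDiffAt ℝ 1 Ψ y := contDiffAt_of_rightInverse_of_injOn hS hU (ht1.prodMk hx1) hinj
    (fun y hy => (hΨ y hy).1) (fun y hy => (hΨ y hy).2) hy hΦ
  have hΨd := (hΨc.differentiableAt one_ne_zero).hasFDerivAt
  set D := fderiv ℝ Ψ y with hD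
  have hid : (e : (ℝ × ℝ) →L[ℝ] (ℝ × ℝ)).comp D = ContinuousLinearMap.id ℝ (ℝ × ℝ) := by
    refine (hΦ.comp y hΨd).unique ((hasFDerivAt_id y).congr_of_eventuallyEq ?_)
    filter_upwards [hU.mem_nhds hy] with w hw using (hΨ w hw).2
  -- Solving these two rows gives `da = Q⁻¹ (dx - dt / l)` and `db = P⁻¹ (dx + dt / m)`: each foot
  -- is constant along its own characteristic, and `P, Q ≥ 1 / 2` bounds the space derivatives of
  -- `W` and `Z` by `2 * C`.
  have hrow : ∀ v : ℝ × ℝ,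
      -(Q (Ψ y) * (l (Ψ y) * m (Ψ y) / (l (Ψ y) + m (Ψ y)))) * (D v).1 +
        P (Ψ y) * (l (Ψ y) * m (Ψ y) / (l (Ψ y) + m (Ψ y))) * (D v).2 = v.1 ∧
      Q (Ψ y) * (l (Ψ y) / (l (Ψ y) + m (Ψ y))) * (D v).1 +
        P (Ψ y) * (m (Ψ y) / (l (Ψ y) + m (Ψ y))) * (D v).2 = v.2 := by
    intro v
    have := congrArg (fun A : (ℝ × ℝ) →L[ℝ] (ℝ × ℝ) => A v) hid
    rw [he] at this
    simp only [ContinuousLinearMap.comp_apply, ContinuousLinearMap.prod_apply,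
      add_apply, smul_apply, ContinuousLinearMap.coe_fst',
      ContinuousLinearMap.coe_snd', smul_eq_mul, ContinuousLinearMap.id_apply] at this
    exact ⟨congrArg Prod.fst this, congrArg Prod.snd this⟩
  have ha : HasFDerivAt (fun y => (Ψ y).1) ((ContinuousLinearMap.fst ℝ ℝ ℝ).comp D) y := hΨd.fst
  have hb : HasFDerivAt (fun y => (Ψ y).2) ((ContinuousLinearMap.snd ℝ ℝ ℝ).comp D) y := hΨd.snd
  have hfd : HasDerivAt f (deriv f (Ψ y).1) (Ψ y).1 :=
    (hf.differentiable one_ne_zero).differentiableAt.hasDerivAt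
  have hgd : HasDerivAt g (deriv g (Ψ y).2) (Ψ y).2 :=
    (hg.differentiable one_ne_zero).differentiableAt.hasDerivAt
  have hbound : ∀ {r R : ℝ}, |r| ≤ C → 1 / 2 ≤ R → |r * R⁻¹| ≤ 2 * C := by
    intro r R hr hR
    rw [abs_mul, abs_of_pos (inv_pos.2 (by linarith : 0 < R)), mul_comm]
    exact mul_le_mul ((inv_le_comm₀ (by linarith) two_pos).2 (by rwa [inv_eq_one_div])) hr
      (abs_nonneg _) (by norm_num)
  refine ⟨hf.contDiffAt.comp y hΨc.fst, hg.contDiffAt.comp y hΨc.snd, mem_range_self _,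
    mem_range_self _, ⟨deriv f (Ψ y).1 * (Q (Ψ y))⁻¹, hbound (hfC _) hQ1, ?_⟩,
    ⟨deriv g (Ψ y).2 * (P (Ψ y))⁻¹, hbound (hgC _) hP1, ?_⟩⟩
  · refine (hfd.comp_hasFDerivAt y ha).congr_fderiv ?_
    refine ContinuousLinearMap.ext fun v => ?_
    obtain ⟨r1, r2⟩ := hrow v
    change deriv f (Ψ y).1 * (D v).1 = deriv f (Ψ y).1 * (Q (Ψ y))⁻¹ * (v.2 - (l (Ψ y))⁻¹ * v.1)
    rw [← r1, ← r2]
    field_simp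
    ring
  · refine (hgd.comp_hasFDerivAt y hb).congr_fderiv ?_
    refine ContinuousLinearMap.ext fun v => ?_
    obtain ⟨r1, r2⟩ := hrow v
    have e1 : k₂ * f (Ψ y).1 + k₁ * g (Ψ y).2 = -m (Ψ y) := by simp only [hmdef, neg_neg]
    change deriv g (Ψ y).2 * (D v).2 = deriv g (Ψ y).2 * (P (Ψ y))⁻¹ *
      (v.2 - (k₂ * f (Ψ y).1 + k₁ * g (Ψ y).2)⁻¹ * v.1)
    rw [← r1, ← r2, e1]
    field_simp
    ring

/-! ### Maximum principle and uniqueness for the diagonal system -/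

/-- A maximum principle on backward cones for a finite family of functions, each of which, where it
is the largest one and is small and positive, grows at most exponentially along a direction of
bounded speed. -/
lemma nonpos_of_directional_deriv_le {ι : Type*} [Finite ι] {u : ι → ℝ × ℝ → ℝ} {T M C η : ℝ}
    (hM : 0 ≤ M) (hη : 0 < η) (hu : ∀ i, ContinuousOn (u i) (Icc 0 T ×ˢ univ))
    (h0 : ∀ i x, u i (0, x) ≤ 0)
    (H : ∀ t ∈ Ioo 0 T, ∀ x i, 0 < u i (t, x) → u i (t, x) < η →
      (∀ j, u j (t, x) ≤ u i (t, x)) → ∃ μ D, |μ| ≤ M ∧ D ≤ C * u i (t, x) ∧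
        HasDerivAt (fun s => u i (t + s, x + μ * s)) D 0) :
    ∀ t ∈ Ico 0 T, ∀ x i, u i (t, x) ≤ 0 := by
  intro t₀ ht₀ x₀ i₀
  by_contra! hpos
  -- The barrier `ε * exp (L * t)` grows faster than the functions may, and `ε` keeps it below both
  -- `η` and the supposed positive value up to time `T`.
  set L : ℝ := |C| + 1 with hL
  have hL0 : 0 < L := by positivity
  set ε : ℝ := min (u i₀ (t₀, x₀)) η / (2 * Real.exp (L * T)) with hε
  have hε0 : 0 < ε := div_pos (lt_min hpos hη) (by positivity)
  have hsmall : ∀ t, t ≤ T → ε * Real.exp (L * t) ≤ min (u i₀ (t₀, x₀)) η / 2 := by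
    intro t ht
    calc ε * Real.exp (L * t) ≤ ε * Real.exp (L * T) := by gcongr
      _ = _ := by rw [hε]; field_simp
  have hmin0 : 0 < min (u i₀ (t₀, x₀)) η := lt_min hpos hη
  set K : Set (ℝ × ℝ) := {z | (0 ≤ z.1 ∧ z.1 ≤ t₀) ∧ |z.2 - x₀| ≤ M * (t₀ - z.1)} with hKdef
  have hKc : IsClosed K := by
    have h1 : IsClosed {z : ℝ × ℝ | 0 ≤ z.1} := isClosed_le (by fun_prop) (by fun_prop)
    have h2 : IsClosed {z : ℝ × ℝ | z.1 ≤ t₀} := isClosed_le (by fun_prop) (by fun_prop)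
    have h3 : IsClosed {z : ℝ × ℝ | |z.2 - x₀| ≤ M * (t₀ - z.1)} :=
      isClosed_le (by fun_prop) (by fun_prop)
    exact (h1.inter h2).inter h3
  have hKsub : K ⊆ Icc 0 T ×ˢ univ := fun z hz => ⟨⟨hz.1.1, hz.1.2.trans ht₀.2.le⟩, trivial⟩
  have hK : IsCompact K := by
    refine (isCompact_Icc.prod isCompact_Icc).of_isClosed_subset
      (s := Icc 0 t₀ ×ˢ Icc (x₀ - M * t₀) (x₀ + M * t₀)) hKc fun z hz => ⟨hz.1, ?_⟩
    have h1 := abs_le.1 hz.2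
    have h2 := mul_nonneg hM hz.1.1
    constructor <;> nlinarith [h1.1, h1.2]
  have hcont : ∀ i, ContinuousOn (fun z : ℝ × ℝ => u i z - ε * Real.exp (L * z.1))
      (Icc 0 T ×ˢ univ) := fun i => (hu i).sub (by fun_prop)
  -- Points of the backward cone from `(t₀, x₀)` where some function reaches the barrier. The set is
  -- compact, so it has an earliest point.
  set Bad : Set (ℝ × ℝ) := ⋃ i, K ∩ (fun z : ℝ × ℝ => u i z - ε * Real.exp (L * z.1)) ⁻¹' Ici 0
  have hBad : IsCompact Bad := isCompact_iUnion fun i => hK.of_isClosed_subset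
    (((hcont i).mono hKsub).preimage_isClosed_of_isClosed hKc isClosed_Ici) inter_subset_left
  have hne : Bad.Nonempty := by
    refine ⟨(t₀, x₀), mem_iUnion.2 ⟨i₀, ⟨⟨ht₀.1, le_rfl⟩, by simp⟩, ?_⟩⟩
    have h1 := hsmall t₀ ht₀.2.le
    have h2 := min_le_left (u i₀ (t₀, x₀)) η
    simp only [mem_preimage, mem_Ici]
    linarith
  obtain ⟨⟨t, x⟩, hz, hmin⟩ := hBad.exists_isMinOn hne continuous_fst.continuousOn
  obtain ⟨i, hzK, hzi⟩ := mem_iUnion.1 hz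
  simp only [mem_preimage, mem_Ici, sub_nonneg] at hzi
  obtain ⟨⟨ht0, htt⟩, hcone⟩ := hzK
  simp only at ht0 htt hcone
  have hbefore : ∀ z ∈ K, z.1 < t → ∀ j, u j z < ε * Real.exp (L * z.1) := by
    intro z hzK hzt j
    by_contra! hle
    have hzB : z ∈ Bad := mem_iUnion.2 ⟨j, hzK, by simpa using hle⟩
    exact absurd (isMinOn_iff.1 hmin z hzB) (not_le.2 hzt)
  have htpos : 0 < t := by
    rcases ht0.lt_or_eq with h | h
    · exact h
    · rw [← h] at hzi
      have := h0 i x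
      simp only [mul_zero, Real.exp_zero, mul_one] at hzi
      linarith
  have htT : t < T := htt.trans_lt ht₀.2
  -- The vertical segment below the touching point lies in the cone, so by continuity no function
  -- exceeds the barrier there; the touching one is therefore the largest.
  have hle : ∀ j, u j (t, x) ≤ ε * Real.exp (L * t) := by
    intro j
    have hc : ContinuousWithinAt (fun s : ℝ => u j (s, x) - ε * Real.exp (L * s)) (Ioo 0 t) t := by
      have h1 : ContinuousWithinAt (fun z : ℝ × ℝ => u j z - ε * Real.exp (L * z.1))
        (Icc 0 T ×ˢ univ) (t, x) := hcont j (t, x) ⟨⟨ht0, htT.le⟩, trivial⟩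
      exact h1.comp (f := fun s : ℝ => (s, x)) (s := Ioo 0 t) (by fun_prop)
        fun s hs => ⟨⟨hs.1.le, (hs.2.trans htT).le⟩, trivial⟩
    have : (𝓝[Ioo 0 t] t).NeBot := by
      rw [← mem_closure_iff_nhdsWithin_neBot, closure_Ioo htpos.ne]
      exact right_mem_Icc.2 htpos.le
    refine sub_nonpos.1 (le_of_tendsto hc (eventually_mem_nhdsWithin.mono fun s hs => ?_))
    refine sub_nonpos.2 (hbefore (s, x) ⟨⟨hs.1.le, (hs.2.le).trans htt⟩, ?_⟩ hs.2 j).le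
    exact hcone.trans (mul_le_mul_of_nonneg_left (by linarith [hs.2]) hM)
  have heq : u i (t, x) = ε * Real.exp (L * t) := le_antisymm (hle i) hzi
  have hui : 0 < u i (t, x) := by rw [heq]; positivity
  obtain ⟨μ, D, hμ, hD, hder⟩ := H t ⟨htpos, htT⟩ x i hui
    (by
      have h1 := hsmall t htT.le
      have h2 := min_le_right (u i₀ (t₀, x₀)) η
      linarith) (fun j => (hle j).trans_eq heq.symm)
  have hexp : HasDerivAt (fun s => ε * Real.exp (L * (t + s))) (ε * (Real.exp (L * t) * L)) 0 := by
    have := ((((hasDerivAt_id (0 : ℝ)).const_add t).const_mul L).exp).const_mul ε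
    simpa using this
  have hψ := (hder.sub hexp).tendsto_slope_zero_left
  -- Going backwards at speed at most `M` stays in the cone, where the function is below the
  -- barrier; hence it meets the barrier with at least the barrier's slope, contradicting `D ≤ C *
  -- u`.
  have hge : 0 ≤ D - ε * (Real.exp (L * t) * L) := by
    refine ge_of_tendsto hψ ?_
    filter_upwards [Ioo_mem_nhdsLT (neg_lt_zero.2 htpos)] with s hs
    have h1 := hbefore (t + s, x + μ * s) ⟨⟨by linarith [hs.1], by linarith [hs.2]⟩, ?_⟩
      (by linarith [hs.2]) i
    · simp only [zero_add, Pi.sub_apply, mul_zero, add_zero, heq, sub_self, sub_zero, smul_eq_mul]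
      exact mul_nonneg_of_nonpos_of_nonpos (inv_nonpos.2 hs.2.le) (sub_nonpos.2 h1.le)
    · have h2 : |μ * s| ≤ M * (-s) := by
        rw [abs_mul, abs_of_neg hs.2]
        exact mul_le_mul_of_nonneg_right hμ (by linarith [hs.2])
      have h3 : |x + μ * s - x₀| ≤ |x - x₀| + |μ * s| := by
        rw [add_sub_right_comm]; exact abs_add_le _ _
      simp only
      linarith
  have h4 : ε * (Real.exp (L * t) * L) = u i (t, x) * L := by rw [heq]; ring
  rw [h4, hL] at hge
  nlinarith [le_abs_self C]

/-- Along the direction `v'⁻¹` the function `W'` is stationary, so only `W` contributes, by `-d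
(v'⁻¹ - v⁻¹)`. The speed difference is controlled by `e`, which makes the result quadratic in `e`,
and no bound on `d'` is required. -/
lemma hasDerivAt_sq_sub_along {W W' : ℝ × ℝ → ℝ} {t x d d' v v' c e D₀ : ℝ} (hc : 0 < c)
    (hd : |d| ≤ D₀) (he : |W' (t, x) - W (t, x)| = e)
    (hv : c ≤ |v|) (hv' : c / 2 ≤ |v'|) (hvv : |v' - v| ≤ e)
    (hW : HasFDerivAt W (d • (ContinuousLinearMap.snd ℝ ℝ ℝ -
      v⁻¹ • ContinuousLinearMap.fst ℝ ℝ ℝ)) (t, x))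
    (hW' : HasFDerivAt W' (d' • (ContinuousLinearMap.snd ℝ ℝ ℝ -
      v'⁻¹ • ContinuousLinearMap.fst ℝ ℝ ℝ)) (t, x)) :
    ∃ μ D, |μ| ≤ 2 / c ∧ D ≤ 4 * D₀ / c ^ 2 * (W' (t, x) - W (t, x)) ^ 2 ∧
      HasDerivAt (fun s => (W' (t + s, x + μ * s) - W (t + s, x + μ * s)) ^ 2) D 0 := by
  have hv0 : 0 < |v| := hc.trans_le hv
  have hv0' : 0 < |v'| := (half_pos hc).trans_le hv'
  have hvne : v ≠ 0 := abs_pos.1 hv0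
  have hvne' : v' ≠ 0 := abs_pos.1 hv0'
  have hline : HasDerivAt (fun s : ℝ => (t + s, x + v'⁻¹ * s)) (1, v'⁻¹) 0 := by
    have h1 := (hasDerivAt_id (0 : ℝ)).const_add t
    have h2 := ((hasDerivAt_id (0 : ℝ)).const_mul v'⁻¹).const_add x
    simpa using h1.prodMk h2
  have e0 : (t, x) = (t + 0, x + v'⁻¹ * 0) := by simp
  rw [e0] at hW hW'
  have hder := ((hW'.comp_hasDerivAt (0 : ℝ) hline).sub (hW.comp_hasDerivAt (0 : ℝ) hline)).pow 2
  refine ⟨v'⁻¹, 2 * (W' (t, x) - W (t, x)) * (-(d * (v'⁻¹ - v⁻¹))), ?_, ?_,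
    hder.congr_deriv ?_⟩
  · rw [abs_inv, inv_le_comm₀ hv0' (by positivity), inv_div]
    exact hv'
  · have h1 : |v'⁻¹ - v⁻¹| ≤ 2 / c ^ 2 * e := by
      rw [inv_sub_inv hvne' hvne, abs_div, abs_mul, abs_sub_comm, div_le_iff₀ (by positivity)]
      have h2 : c ^ 2 / 2 ≤ |v'| * |v| := by nlinarith [mul_le_mul hv' hv hc.le hv0'.le]
      have he0 : 0 ≤ e := he ▸ abs_nonneg _
      calc |v' - v| ≤ e := hvv
        _ = 2 / c ^ 2 * e * (c ^ 2 / 2) := by field_simp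
        _ ≤ _ := mul_le_mul_of_nonneg_left h2 (by positivity)
    have h3 : |d * (v'⁻¹ - v⁻¹)| ≤ D₀ * (2 / c ^ 2 * e) := by
      rw [abs_mul]
      exact mul_le_mul hd h1 (abs_nonneg _) ((abs_nonneg _).trans hd)
    calc _ ≤ |2 * (W' (t, x) - W (t, x)) * (-(d * (v'⁻¹ - v⁻¹)))| := le_abs_self _
      _ = 2 * e * |d * (v'⁻¹ - v⁻¹)| := by
          rw [abs_mul, abs_mul, he, abs_neg, abs_of_pos (two_pos : (0 : ℝ) < 2)]
      _ ≤ 2 * e * (D₀ * (2 / c ^ 2 * e)) :=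
          mul_le_mul_of_nonneg_left h3 (by have := abs_nonneg (W' (t, x) - W (t, x)); linarith)
      _ = 4 * D₀ / c ^ 2 * e ^ 2 := by ring
      _ = _ := by rw [← he, sq_abs]
  · simp [Function.comp_def]

/-- Uniqueness for the diagonal system within continuous functions which satisfy it wherever they
are close to the given solution. -/
lemma diagonal_solution_unique {W Z W' Z' : ℝ × ℝ → ℝ} {k₁ k₂ c D₀ T : ℝ}
    (hk₁ : 0 ≤ k₁) (hk₂ : 0 ≤ k₂) (hk : k₁ + k₂ = 1) (hc : 0 < c)
    (hWc : ContinuousOn W (Icc 0 T ×ˢ univ)) (hZc : ContinuousOn Z (Icc 0 T ×ˢ univ))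
    (hWc' : ContinuousOn W' (Icc 0 T ×ˢ univ)) (hZc' : ContinuousOn Z' (Icc 0 T ×ˢ univ))
    (hW0 : ∀ x, W' (0, x) = W (0, x)) (hZ0 : ∀ x, Z' (0, x) = Z (0, x))
    (hl : ∀ t ∈ Ioo 0 T, ∀ x, c ≤ k₁ * W (t, x) + k₂ * Z (t, x))
    (hm : ∀ t ∈ Ioo 0 T, ∀ x, k₂ * W (t, x) + k₁ * Z (t, x) ≤ -c)
    (hWd : ∀ t ∈ Ioo 0 T, ∀ x, ∃ d : ℝ, |d| ≤ D₀ ∧ HasFDerivAt W (d • (ContinuousLinearMap.snd ℝ ℝ ℝ -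
      (k₁ * W (t, x) + k₂ * Z (t, x))⁻¹ • ContinuousLinearMap.fst ℝ ℝ ℝ)) (t, x))
    (hZd : ∀ t ∈ Ioo 0 T, ∀ x, ∃ d : ℝ, |d| ≤ D₀ ∧ HasFDerivAt Z (d • (ContinuousLinearMap.snd ℝ ℝ ℝ -
      (k₂ * W (t, x) + k₁ * Z (t, x))⁻¹ • ContinuousLinearMap.fst ℝ ℝ ℝ)) (t, x))
    (hWZ' : ∀ t ∈ Ioo 0 T, ∀ x, |W' (t, x) - W (t, x)| ≤ c / 2 → |Z' (t, x) - Z (t, x)| ≤ c / 2 →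
      (∃ d : ℝ, HasFDerivAt W' (d • (ContinuousLinearMap.snd ℝ ℝ ℝ -
        (k₁ * W' (t, x) + k₂ * Z' (t, x))⁻¹ • ContinuousLinearMap.fst ℝ ℝ ℝ)) (t, x)) ∧
      ∃ d : ℝ, HasFDerivAt Z' (d • (ContinuousLinearMap.snd ℝ ℝ ℝ -
        (k₂ * W' (t, x) + k₁ * Z' (t, x))⁻¹ • ContinuousLinearMap.fst ℝ ℝ ℝ)) (t, x)) :
    ∀ t ∈ Ico 0 T, ∀ x, W' (t, x) = W (t, x) ∧ Z' (t, x) = Z (t, x) := by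
  have key := nonpos_of_directional_deriv_le (T := T) (M := 2 / c) (C := 4 * D₀ / c ^ 2)
    -- Below this threshold both differences are less than `c / 2` at a maximal index, so the
    -- reciprocal speeds of the competitor keep their signs and stay at least `c / 2` in size.
    (η := (c / 2) ^ 2)
    (u := fun b : Bool => if b then fun z => (W' z - W z) ^ 2 else fun z => (Z' z - Z z) ^ 2)
    (by positivity) (by positivity)
    (by
      rintro (_ | _)
      · exact (hZc'.sub hZc).pow 2
      · exact (hWc'.sub hWc).pow 2)
    (by rintro (_ | _) x <;> simp [hW0, hZ0])
    (by
      have hmix : ∀ {A B a b e r s : ℝ}, 0 ≤ r → 0 ≤ s → r + s = 1 → |A - a| ≤ e → |B - b| ≤ e →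
          |(r * A + s * B) - (r * a + s * b)| ≤ e := by
        intro A B a b e r s hr hs hrs hA hB
        calc |(r * A + s * B) - (r * a + s * b)| = |r * (A - a) + s * (B - b)| := by ring_nf
          _ ≤ |r * (A - a)| + |s * (B - b)| := abs_add_le _ _
          _ = r * |A - a| + s * |B - b| := by rw [abs_mul, abs_mul, abs_of_nonneg hr,
              abs_of_nonneg hs]
          _ ≤ r * e + s * e := by gcongr
          _ = e := by rw [← add_mul, hrs, one_mul]
      rintro t ht x (_ | _) - hlt hmax
      · have hWe : |W' (t, x) - W (t, x)| ≤ |Z' (t, x) - Z (t, x)| := sq_le_sq.1 (hmax true)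
        have hZe : |Z' (t, x) - Z (t, x)| ≤ c / 2 := (abs_lt_of_sq_lt_sq hlt (by positivity)).le
        obtain ⟨-, d', hd'⟩ := hWZ' t ht x (hWe.trans hZe) hZe
        obtain ⟨d, hd, hdZ⟩ := hZd t ht x
        have hv := hmix hk₂ hk₁ (by linarith) hWe le_rfl
        have h1 := hm t ht x
        have h2 := (abs_le.1 (hv.trans hZe)).2
        exact hasDerivAt_sq_sub_along hc hd rfl (by rw [le_abs]; right; linarith)
          (by rw [le_abs]; right; linarith) hv hdZ hd'
      · have hZe : |Z' (t, x) - Z (t, x)| ≤ |W' (t, x) - W (t, x)| := sq_le_sq.1 (hmax false)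
        have hWe : |W' (t, x) - W (t, x)| ≤ c / 2 := (abs_lt_of_sq_lt_sq hlt (by positivity)).le
        obtain ⟨⟨d', hd'⟩, -⟩ := hWZ' t ht x hWe (hZe.trans hWe)
        obtain ⟨d, hd, hdW⟩ := hWd t ht x
        have hv := hmix hk₁ hk₂ hk le_rfl hZe
        have h1 := hl t ht x
        have h2 := (abs_le.1 (hv.trans hWe)).1
        exact hasDerivAt_sq_sub_along hc hd rfl (by rw [le_abs]; left; linarith)
          (by rw [le_abs]; left; linarith) hv hdW hd')
  intro t ht x
  have hsq : ∀ {r s : ℝ}, (r - s) ^ 2 ≤ 0 → r = s := fun h =>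
    sub_eq_zero.1 (pow_eq_zero_iff two_ne_zero |>.1 (le_antisymm h (sq_nonneg _)))
  exact ⟨hsq (key t ht x true), hsq (key t ht x false)⟩

/-! ### The fluid equations in Riemann invariants -/

namespace Carroll

lemma theta_pos {γ : ℝ} (hγ : 1 < γ) : 0 < theta γ := by unfold theta; linarith

lemma theta_le_one {γ : ℝ} (hγ : γ ≤ 3) : theta γ ≤ 1 := by unfold theta; linarith

lemma w1_sub_w2 (γ σ β : ℝ) : w1 γ σ β - w2 γ σ β = 2 * σ ^ theta γ / theta γ := by
  unfold w1 w2; ring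

/-- This is the reciprocal of the first characteristic speed. The weights sum to one and are
nonnegative exactly because `0 < θ ≤ 1`, as the diagonal theory requires. -/
lemma first_eigenvalue_eq {γ : ℝ} (hγ : 1 < γ) (σ β : ℝ) :
    (1 + theta γ) / 2 * w1 γ σ β + (1 - theta γ) / 2 * w2 γ σ β = β + σ ^ theta γ := by
  have := (theta_pos hγ).ne'
  unfold w1 w2
  field_simp
  ring

lemma second_eigenvalue_eq {γ : ℝ} (hγ : 1 < γ) (σ β : ℝ) :
    (1 - theta γ) / 2 * w1 γ σ β + (1 + theta γ) / 2 * w2 γ σ β = β - σ ^ theta γ := by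
  have := (theta_pos hγ).ne'
  unfold w1 w2
  field_simp
  ring

/-- The fluid equations, differentiated out, are equivalent to the diagonal system for the
Riemann invariants away from vacuum; here `s` stands for `σ ^ (θ - 1)`. -/
lemma equations_iff_diagonal {s σ β σt σx βt βx : ℝ} (hs : s ≠ 0) (hσ : σ ≠ 0) :
    (βt * σ + β * σt + σx = 0 ∧
      (s * σ) ^ 2 * σt + (2 * β * βt * σ + β ^ 2 * σt) + (βx * σ + β * σx) = 0) ↔
    ((βx + s * σx) + (β + s * σ) * (βt + s * σt) = 0 ∧
      (βx - s * σx) + (β - s * σ) * (βt - s * σt) = 0) := by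
  constructor
  · rintro ⟨h1, h2⟩
    have h3 : s ^ 2 * σ * σt + β * βt + βx = 0 := by
      have : σ * (s ^ 2 * σ * σt + β * βt + βx) = 0 := by linear_combination h2 - β * h1
      exact (mul_eq_zero_iff_left hσ).1 this
    constructor
    · linear_combination h3 + s * h1
    · linear_combination h3 - s * h1
  · rintro ⟨h1, h2⟩
    have h3 : βt * σ + β * σt + σx = 0 := by
      have : s * (βt * σ + β * σt + σx) = 0 := by linear_combination (h1 - h2) / 2
      exact (mul_eq_zero_iff_left hs).1 this
    refine ⟨h3, ?_⟩
    linear_combination σ * (h1 + h2) / 2 + β * h3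

/-- Positivity of the density makes the powers differentiable. The pointwise equivalence serves both
directions: existence reads it from the diagonal system, uniqueness from the fluid equations. -/
lemma fluid_equations_iff {γ : ℝ} (hγ : 1 < γ) {σ β : ℝ → ℝ → ℝ} {t x : ℝ} (hpos : 0 < σ t x)
    {S B : ℝ × ℝ →L[ℝ] ℝ} (hσ : HasFDerivAt (Function.uncurry σ) S (t, x))
    (hβ : HasFDerivAt (Function.uncurry β) B (t, x)) :
    ∃ W Z : ℝ × ℝ →L[ℝ] ℝ, HasFDerivAt (fun y : ℝ × ℝ => w1 γ (σ y.1 y.2) (β y.1 y.2)) W (t, x) ∧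
      HasFDerivAt (fun y : ℝ × ℝ => w2 γ (σ y.1 y.2) (β y.1 y.2)) Z (t, x) ∧
      ((deriv (fun s => β s x * σ s x) t + deriv (fun y => σ t y) x = 0 ∧
        deriv (fun s => γ⁻¹ * σ s x ^ γ + β s x ^ 2 * σ s x) t
          + deriv (fun y => β t y * σ t y) x = 0) ↔
      (W (0, 1) + (β t x + σ t x ^ theta γ) * W (1, 0) = 0 ∧
        Z (0, 1) + (β t x - σ t x ^ theta γ) * Z (1, 0) = 0)) := by
  have hθ := theta_pos hγ
  have hθ0 := hθ.ne'
  have hγ0 : γ ≠ 0 := by linarith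
  have hroot : HasFDerivAt (fun y : ℝ × ℝ => σ y.1 y.2 ^ theta γ / theta γ)
      (σ t x ^ (theta γ - 1) • S) (t, x) := by
    have h1 : HasDerivAt (fun r : ℝ => r ^ theta γ / theta γ) (σ t x ^ (theta γ - 1)) (σ t x) := by
      refine ((Real.hasDerivAt_rpow_const (Or.inl hpos.ne')).div_const _).congr_deriv ?_
      field_simp
    exact h1.comp_hasFDerivAt (t, x) hσ
  refine ⟨B + σ t x ^ (theta γ - 1) • S, B - σ t x ^ (theta γ - 1) • S, hβ.add hroot,
    hβ.sub hroot, ?_⟩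
  have ht : HasDerivAt (fun s : ℝ => (s, x)) (1, 0) t :=
    (hasDerivAt_id t).prodMk (hasDerivAt_const t x)
  have hx : HasDerivAt (fun y : ℝ => (t, y)) (0, 1) x :=
    (hasDerivAt_const x t).prodMk (hasDerivAt_id x)
  have σt : HasDerivAt (fun s => σ s x) (S (1, 0)) t := hσ.comp_hasDerivAt (f := fun s : ℝ => (s, x)) t ht
  have σx : HasDerivAt (fun y => σ t y) (S (0, 1)) x := hσ.comp_hasDerivAt (f := fun y : ℝ => (t, y)) x hx
  have βt : HasDerivAt (fun s => β s x) (B (1, 0)) t := hβ.comp_hasDerivAt (f := fun s : ℝ => (s, x)) t ht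
  have βx : HasDerivAt (fun y => β t y) (B (0, 1)) x := hβ.comp_hasDerivAt (f := fun y : ℝ => (t, y)) x hx
  have d1 : deriv (fun s => β s x * σ s x) t = B (1, 0) * σ t x + β t x * S (1, 0) :=
    (βt.mul σt).deriv
  have d2 : deriv (fun y => σ t y) x = S (0, 1) := σx.deriv
  have d3 : deriv (fun s => γ⁻¹ * σ s x ^ γ + β s x ^ 2 * σ s x) t =
      (σ t x ^ (theta γ - 1) * σ t x) ^ 2 * S (1, 0) +
        (2 * β t x * B (1, 0) * σ t x + β t x ^ 2 * S (1, 0)) := by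
    have h1 := (((σt.rpow_const (p := γ) (Or.inl hpos.ne')).const_mul γ⁻¹).add
      ((βt.pow 2).mul σt)).deriv
    -- This is `γ - 1 = 2 θ`; it lets the pressure term factor through the characteristic speeds.
    have h2 : σ t x ^ (γ - 1) = (σ t x ^ (theta γ - 1) * σ t x) ^ 2 := by
      rw [← Real.rpow_add_one hpos.ne', sub_add_cancel, ← Real.rpow_mul_natCast hpos.le]
      congr 1
      unfold theta
      push_cast
      ring
    rw [← h2]
    refine Eq.trans h1 ?_
    simp only [Pi.pow_apply]
    field_simp
    ring
  have d4 : deriv (fun y => β t y * σ t y) x = B (0, 1) * σ t x + β t x * S (0, 1) :=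
    (βx.mul σx).deriv
  have hs : σ t x ^ theta γ = σ t x ^ (theta γ - 1) * σ t x := by
    rw [← Real.rpow_add_one hpos.ne', sub_add_cancel]
  rw [d1, d2, d3, d4, hs, equations_iff_diagonal (Real.rpow_pos_of_pos hpos _).ne' hpos.ne']
  rfl

/-- Transport along characteristics creates no new values of the invariants, so conditions on their
extrema can only improve. -/
lemma SignCondition.of_range_subset {γ : ℝ} {s b s' b' : ℝ → ℝ} (h : SignCondition γ s b)
    (h1 : ∀ x, w1 γ (s' x) (b' x) ∈ range fun x => w1 γ (s x) (b x))
    (h2 : ∀ x, w2 γ (s' x) (b' x) ∈ range fun x => w2 γ (s x) (b x)) :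
    SignCondition γ s' b' := by
  obtain ⟨hb1, hb2, hp1, hp2⟩ := h
  have r1 := range_subset_iff.2 h1
  have r2 := range_subset_iff.2 h2
  exact ⟨hb1.mono r1, hb2.mono r2, hp1.trans_le (csInf_le_csInf hb1 (range_nonempty _) r1),
    (csSup_le_csSup hb2 (range_nonempty _) r2).trans_lt hp2⟩

lemma HyperbolicityCondition.of_range_subset {γ : ℝ} (hγ : 1 < γ) {s b s' b' : ℝ → ℝ}
    (h : HyperbolicityCondition γ s b)
    (h1 : ∀ x, w1 γ (s' x) (b' x) ∈ range fun x => w1 γ (s x) (b x))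
    (h2 : ∀ x, w2 γ (s' x) (b' x) ∈ range fun x => w2 γ (s x) (b x)) :
    HyperbolicityCondition γ s' b' := by
  obtain ⟨hb1, hb2, hp1, hp2⟩ := h
  have hθ := theta_pos hγ
  have r1 := range_subset_iff.2 h1
  have r2 := range_subset_iff.2 h2
  have i1 : (⨅ x, w1 γ (s x) (b x)) ≤ ⨅ x, w1 γ (s' x) (b' x) :=
    csInf_le_csInf hb1.bddBelow (range_nonempty _) r1
  have i2 : (⨅ x, w2 γ (s x) (b x)) ≤ ⨅ x, w2 γ (s' x) (b' x) :=
    csInf_le_csInf hb2.bddBelow (range_nonempty _) r2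
  have s1 : (⨆ x, w1 γ (s' x) (b' x)) ≤ ⨆ x, w1 γ (s x) (b x) :=
    csSup_le_csSup hb1.bddAbove (range_nonempty _) r1
  have s2 : (⨆ x, w2 γ (s' x) (b' x)) ≤ ⨆ x, w2 γ (s x) (b x) :=
    csSup_le_csSup hb2.bddAbove (range_nonempty _) r2
  refine ⟨hb1.subset r1, hb2.subset r2, ?_, ?_⟩
  · nlinarith [mul_le_mul_of_nonneg_left i1 hθ.le, mul_le_mul_of_nonneg_left s2 hθ.le]
  · nlinarith [mul_le_mul_of_nonneg_left i1 hθ.le, mul_le_mul_of_nonneg_left s2 hθ.le]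

/-- The two characteristic speeds in the `x`-evolution are uniformly positive and negative. -/
lemma exists_eigenvalue_bound {γ : ℝ} (hγ : 1 < γ) (hγ' : γ ≤ 3) {s b : ℝ → ℝ}
    (hsign : SignCondition γ s b) (hhyp : γ < 3 → HyperbolicityCondition γ s b) :
    ∃ c : ℝ, 0 < c ∧
      (∀ x y, c ≤ (1 + theta γ) / 2 * w1 γ (s x) (b x) + (1 - theta γ) / 2 * w2 γ (s y) (b y)) ∧
      ∀ x y, (1 - theta γ) / 2 * w1 γ (s x) (b x) + (1 + theta γ) / 2 * w2 γ (s y) (b y) ≤ -c := by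
  have hθ := theta_pos hγ
  rcases hγ'.lt_or_eq with h3 | h3
  · obtain ⟨hb1, hb2, hp1, hp2⟩ := hhyp h3
    set i1 := ⨅ x, w1 γ (s x) (b x)
    set i2 := ⨅ x, w2 γ (s x) (b x)
    set s1 := ⨆ x, w1 γ (s x) (b x)
    set s2 := ⨆ x, w2 γ (s x) (b x)
    have j1 : ∀ x, i1 ≤ w1 γ (s x) (b x) := fun x => ciInf_le hb1.bddBelow x
    have j2 : ∀ x, i2 ≤ w2 γ (s x) (b x) := fun x => ciInf_le hb2.bddBelow x
    have k1 : ∀ x, w1 γ (s x) (b x) ≤ s1 := fun x => le_ciSup hb1.bddAbove x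
    have k2 : ∀ x, w2 γ (s x) (b x) ≤ s2 := fun x => le_ciSup hb2.bddAbove x
    have hθ1 : theta γ < 1 := by unfold theta; linarith
    -- Half of each gap in (B): the coefficient `1 ∓ θ` is split, and the two terms are estimated by
    -- opposite extrema.
    refine ⟨min (((1 + theta γ) * i1 - (theta γ * s2 - i2)) / 2)
      (-((s1 - theta γ * i1) + (1 + theta γ) * s2) / 2),
      lt_min (by linarith) (by linarith), fun x y => (min_le_left _ _).trans ?_,
      fun x y => le_neg_of_le_neg ((min_le_right _ _).trans ?_)⟩
    · nlinarith [mul_le_mul_of_nonneg_left (j1 x) hθ.le, j1 x, j2 y, k2 y,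
        mul_le_mul_of_nonneg_left ((j2 y).trans (k2 y)) hθ.le,
        mul_le_mul_of_nonneg_left (k2 y) hθ.le]
    · nlinarith [mul_le_mul_of_nonneg_left (j1 x) hθ.le, k1 x, k2 y,
        mul_le_mul_of_nonneg_left (k2 y) hθ.le]
  · obtain ⟨hb1, hb2, hp1, hp2⟩ := hsign
    -- The reciprocal speeds are now `w₁` and `w₂` themselves, so the sign condition alone bounds
    -- them.
    have hθ1 : theta γ = 1 := by unfold theta; linarith
    have j1 : ∀ x, (⨅ x, w1 γ (s x) (b x)) ≤ w1 γ (s x) (b x) := fun x => ciInf_le hb1 x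
    have k2 : ∀ x, w2 γ (s x) (b x) ≤ ⨆ x, w2 γ (s x) (b x) := fun x => le_ciSup hb2 x
    refine ⟨min (⨅ x, w1 γ (s x) (b x)) (-⨆ x, w2 γ (s x) (b x)), lt_min hp1 (neg_pos.2 hp2),
      fun x y => (min_le_left _ _).trans ?_, fun x y => le_neg_of_le_neg ((min_le_right _ _).trans ?_)⟩
    · rw [hθ1]; linarith [j1 x]
    · rw [hθ1]; linarith [k2 y]

/-- The Riemann invariants of admissible data are `C¹` with bounded derivatives. -/
lemma contDiff_riemann_invariants {γ : ℝ} (hγ : 1 < γ) (hγ' : γ ≤ 3) {s b : ℝ → ℝ}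
    (hs : ContDiff ℝ 1 s) (hb : ContDiff ℝ 1 b)
    (hbdd : ∃ C : ℝ, ∀ x, |deriv s x| ≤ C ∧ |deriv b x| ≤ C) (hpos : ∀ x, 0 ≤ s x)
    (hsign : SignCondition γ s b) :
    ContDiff ℝ 1 (fun x => w1 γ (s x) (b x)) ∧ ContDiff ℝ 1 (fun x => w2 γ (s x) (b x)) ∧
      ∃ C : ℝ, (∀ x, |deriv (fun x => w1 γ (s x) (b x)) x| ≤ C) ∧
        ∀ x, |deriv (fun x => w2 γ (s x) (b x)) x| ≤ C := by
  have hθ := theta_pos hγ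
  have hθ0 := hθ.ne'
  obtain ⟨hb1, hb2, hp1, hp2⟩ := hsign
  obtain ⟨C, hC⟩ := hbdd
  set i1 := ⨅ x, w1 γ (s x) (b x)
  set s2 := ⨆ x, w2 γ (s x) (b x)
  -- The gap between `inf w₁` and `sup w₂` keeps the density uniformly away from vacuum, so the
  -- factor `s ^ (θ - 1)`, with nonpositive exponent, is bounded.
  have hgap : ∀ x, theta γ * (i1 - s2) / 2 ≤ s x ^ theta γ := by
    intro x
    have h1 : i1 ≤ w1 γ (s x) (b x) := ciInf_le hb1 x
    have h2 : w2 γ (s x) (b x) ≤ s2 := le_ciSup hb2 x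
    have h3 := w1_sub_w2 γ (s x) (b x)
    have h4 : theta γ * (2 * s x ^ theta γ / theta γ) = 2 * s x ^ theta γ := by field_simp
    nlinarith [mul_le_mul_of_nonneg_left (by linarith : i1 - s2 ≤ 2 * s x ^ theta γ / theta γ) hθ.le]
  set r := theta γ * (i1 - s2) / 2
  have hr : 0 < r := by
    have : 0 < i1 - s2 := by linarith
    positivity
  have hlow : ∀ x, r ^ (theta γ)⁻¹ ≤ s x := fun x =>
    (Real.rpow_inv_le_iff_of_pos hr.le (hpos x) hθ).2 (hgap x)
  have hr' : 0 < r ^ (theta γ)⁻¹ := Real.rpow_pos_of_pos hr _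
  have hspos : ∀ x, 0 < s x := fun x => hr'.trans_le (hlow x)
  have hroot : ContDiff ℝ 1 (fun x => s x ^ theta γ / theta γ) :=
    (hs.rpow_const_of_ne fun x => (hspos x).ne').div_const _
  have hsd : ∀ x, HasDerivAt s (deriv s x) x := fun x =>
    (hs.differentiable one_ne_zero).differentiableAt.hasDerivAt
  have hbd : ∀ x, HasDerivAt b (deriv b x) x := fun x =>
    (hb.differentiable one_ne_zero).differentiableAt.hasDerivAt
  have hrd : ∀ x, HasDerivAt (fun x => s x ^ theta γ / theta γ)
      (s x ^ (theta γ - 1) * deriv s x) x := fun x => by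
    refine (((hsd x).rpow_const (Or.inl (hspos x).ne')).div_const _).congr_deriv ?_
    field_simp
  set R := (r ^ (theta γ)⁻¹) ^ (theta γ - 1)
  have hR : ∀ x, |s x ^ (theta γ - 1) * deriv s x| ≤ R * C := fun x => by
    rw [abs_mul, abs_of_pos (Real.rpow_pos_of_pos (hspos x) _)]
    exact mul_le_mul (Real.rpow_le_rpow_of_nonpos hr' (hlow x) (by linarith [theta_le_one hγ']))
      (hC x).1 (abs_nonneg _) (Real.rpow_pos_of_pos hr' _).le
  refine ⟨hb.add hroot, hb.sub hroot, C + R * C, fun x => ?_, fun x => ?_⟩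
  · rw [show deriv (fun x => w1 γ (s x) (b x)) x = _ from ((hbd x).add (hrd x)).deriv]
    exact (abs_add_le _ _).trans (add_le_add (hC x).2 (hR x))
  · rw [show deriv (fun x => w2 γ (s x) (b x)) x = _ from ((hbd x).sub (hrd x)).deriv]
    exact (abs_sub _ _).trans (add_le_add (hC x).2 (hR x))

lemma state_eq_of_invariants_eq {γ σ β σ' β' : ℝ} (hγ : 1 < γ) (hσ : 0 ≤ σ) (hσ' : 0 ≤ σ')
    (h1 : w1 γ σ' β' = w1 γ σ β) (h2 : w2 γ σ' β' = w2 γ σ β) : σ' = σ ∧ β' = β := by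
  have hθ := theta_pos hγ
  have h3 := w1_sub_w2 γ σ β
  rw [← h1, ← h2, w1_sub_w2, div_left_inj' hθ.ne'] at h3
  have h4 : σ' ^ theta γ = σ ^ theta γ := by linarith
  have h5 : σ' = σ := (Real.rpow_left_inj hσ' hσ hθ.ne').1 h4
  refine ⟨h5, ?_⟩
  unfold w1 at h1
  rw [h4] at h1
  linarith

lemma eq_smul_snd_sub {A : ℝ × ℝ →L[ℝ] ℝ} {v : ℝ} (hv : v ≠ 0) (h : A (0, 1) + v * A (1, 0) = 0) :
    A = A (0, 1) • (ContinuousLinearMap.snd ℝ ℝ ℝ - v⁻¹ • ContinuousLinearMap.fst ℝ ℝ ℝ) := by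
  have h1 : A (1, 0) = -(v⁻¹ * A (0, 1)) := by
    field_simp
    linarith
  ext
  · simp [h1, mul_comm]
  · simp

/-! ### Uniqueness for the fluid equations -/

/-- Two `C¹` solutions with the same initial data agree, provided that the Riemann invariants of one
of them have a bounded space derivative and that its characteristic speeds are bounded. -/
lemma solution_unique {γ T c D₀ : ℝ} {σ₀ β₀ : ℝ → ℝ} {σ β σ' β' : ℝ → ℝ → ℝ} (hγ : 1 < γ)
    (hγ' : γ ≤ 3) (hT : 0 < T) (hc : 0 < c)
    (hsol : IsC1CauchySolution γ T σ₀ β₀ σ β) (hsol' : IsC1CauchySolution γ T σ₀ β₀ σ' β')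
    (hl : ∀ t ∈ Icc 0 T, ∀ x, c ≤ β t x + σ t x ^ theta γ)
    (hm : ∀ t ∈ Icc 0 T, ∀ x, β t x - σ t x ^ theta γ ≤ -c)
    (hW : ∀ t ∈ Ioo 0 T, ∀ x, ∃ d : ℝ, |d| ≤ D₀ ∧
      HasFDerivAt (fun y : ℝ × ℝ => w1 γ (σ y.1 y.2) (β y.1 y.2))
        (d • (ContinuousLinearMap.snd ℝ ℝ ℝ -
          (β t x + σ t x ^ theta γ)⁻¹ • ContinuousLinearMap.fst ℝ ℝ ℝ)) (t, x))
    (hZ : ∀ t ∈ Ioo 0 T, ∀ x, ∃ d : ℝ, |d| ≤ D₀ ∧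
      HasFDerivAt (fun y : ℝ × ℝ => w2 γ (σ y.1 y.2) (β y.1 y.2))
        (d • (ContinuousLinearMap.snd ℝ ℝ ℝ -
          (β t x - σ t x ^ theta γ)⁻¹ • ContinuousLinearMap.fst ℝ ℝ ℝ)) (t, x)) :
    ∀ t ∈ Icc 0 T, ∀ x, σ' t x = σ t x ∧ β' t x = β t x := by
  have hθ := theta_pos hγ
  have hθ1 := theta_le_one hγ'
  have hcont : ∀ {σ β : ℝ → ℝ → ℝ}, IsC1Solution γ T σ β →
      ContinuousOn (fun y : ℝ × ℝ => w1 γ (σ y.1 y.2) (β y.1 y.2)) (Icc 0 T ×ˢ univ) ∧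
      ContinuousOn (fun y : ℝ × ℝ => w2 γ (σ y.1 y.2) (β y.1 y.2)) (Icc 0 T ×ˢ univ) := by
    intro σ β h
    have h1 : ContinuousOn (fun y : ℝ × ℝ => σ y.1 y.2 ^ theta γ / theta γ) (Icc 0 T ×ˢ univ) :=
      (h.contDiffOn_sigma.continuousOn.rpow_const fun _ _ => Or.inr hθ.le).div_const _
    exact ⟨h.contDiffOn_beta.continuousOn.add h1, h.contDiffOn_beta.continuousOn.sub h1⟩
  have hdiff : ∀ {u : ℝ → ℝ → ℝ}, ContDiffOn ℝ 1 (Function.uncurry u) (Icc 0 T ×ˢ univ) →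
      ∀ t ∈ Ioo 0 T, ∀ x,
        HasFDerivAt (Function.uncurry u) (fderiv ℝ (Function.uncurry u) (t, x)) (t, x) :=
    fun hu t ht x => ((hu.contDiffAt (prod_mem_nhds (Icc_mem_nhds ht.1 ht.2)
      univ_mem)).differentiableAt one_ne_zero).hasFDerivAt
  obtain ⟨cW, cZ⟩ := hcont hsol.toIsC1Solution
  obtain ⟨cW', cZ'⟩ := hcont hsol'.toIsC1Solution
  have hopen : ∀ t ∈ Ico 0 T, ∀ x,
      w1 γ (σ' t x) (β' t x) = w1 γ (σ t x) (β t x) ∧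
      w2 γ (σ' t x) (β' t x) = w2 γ (σ t x) (β t x) := by
    refine diagonal_solution_unique (k₁ := (1 + theta γ) / 2) (k₂ := (1 - theta γ) / 2)
      (c := c) (D₀ := D₀) (by linarith) (by linarith) (by ring) hc cW cZ cW' cZ' ?_ ?_ ?_ ?_ ?_ ?_ ?_
    · intro x; simp only [hsol.sigma_zero, hsol.beta_zero, hsol'.sigma_zero, hsol'.beta_zero]
    · intro x; simp only [hsol.sigma_zero, hsol.beta_zero, hsol'.sigma_zero, hsol'.beta_zero]
    · intro t ht x
      simpa only [first_eigenvalue_eq hγ] using hl t (Ioo_subset_Icc_self ht) x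
    · intro t ht x
      simpa only [second_eigenvalue_eq hγ] using hm t (Ioo_subset_Icc_self ht) x
    · intro t ht x
      simpa only [first_eigenvalue_eq hγ] using hW t ht x
    · intro t ht x
      simpa only [second_eigenvalue_eq hγ] using hZ t ht x
    · intro t ht x hWe hZe
      simp only [first_eigenvalue_eq hγ, second_eigenvalue_eq hγ] at hWe hZe ⊢
      have hl' := hl t (Ioo_subset_Icc_self ht) x
      have hm' := hm t (Ioo_subset_Icc_self ht) x
      have e1 := abs_le.1 hWe
      have e2 := abs_le.1 hZe
      have f1 := first_eigenvalue_eq hγ (σ t x) (β t x)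
      have f2 := second_eigenvalue_eq hγ (σ t x) (β t x)
      have f1' := first_eigenvalue_eq hγ (σ' t x) (β' t x)
      have f2' := second_eigenvalue_eq hγ (σ' t x) (β' t x)
      have hv1 : c / 2 ≤ β' t x + σ' t x ^ theta γ := by nlinarith
      have hv2 : β' t x - σ' t x ^ theta γ ≤ -(c / 2) := by nlinarith
      -- The competitor is only known to be nonnegative. At vacuum its two reciprocal speeds would
      -- coincide, but closeness keeps one positive and the other negative.
      have hpos : 0 < σ' t x := by
        rcases (hsol'.sigma_nonneg t (Ioo_subset_Icc_self ht) x).lt_or_eq with h0 | h0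
        · exact h0
        · rw [← h0, Real.zero_rpow hθ.ne'] at hv1 hv2
          linarith
      obtain ⟨W, Z, dW, dZ, hiff⟩ := fluid_equations_iff hγ hpos
        (hdiff hsol'.contDiffOn_sigma t ht x) (hdiff hsol'.contDiffOn_beta t ht x)
      obtain ⟨r1, r2⟩ := hiff.1 ⟨hsol'.energy t ht x, hsol'.momentum t ht x⟩
      have n1 : β' t x + σ' t x ^ theta γ ≠ 0 := by linarith
      have n2 : β' t x - σ' t x ^ theta γ ≠ 0 := by linarith
      exact ⟨⟨W (0, 1), eq_smul_snd_sub n1 r1 ▸ dW⟩, ⟨Z (0, 1), eq_smul_snd_sub n2 r2 ▸ dZ⟩⟩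
  have hclosed : ∀ {u u' : ℝ × ℝ → ℝ}, ContinuousOn u (Icc 0 T ×ˢ univ) →
      ContinuousOn u' (Icc 0 T ×ˢ univ) → (∀ t ∈ Ico 0 T, ∀ x, u' (t, x) = u (t, x)) →
      ∀ t ∈ Icc 0 T, ∀ x, u' (t, x) = u (t, x) := by
    intro u u' hu hu' he t ht x
    have hline : MapsTo (fun s : ℝ => (s, x)) (Icc 0 T) (Icc 0 T ×ˢ univ) :=
      fun s hs => ⟨hs, trivial⟩
    have hlc : ContinuousOn (fun s : ℝ => (s, x)) (Icc 0 T) := by fun_prop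
    exact EqOn.of_subset_closure (s := Ico 0 T) (t := Icc 0 T)
      (f := fun s => u' (s, x)) (g := fun s => u (s, x)) (fun s hs => he s hs x)
      (hu'.comp hlc hline) (hu.comp hlc hline) Ico_subset_Icc_self
      (by rw [closure_Ico hT.ne]) ht
  intro t ht x
  exact state_eq_of_invariants_eq hγ (hsol.sigma_nonneg t ht x) (hsol'.sigma_nonneg t ht x)
    (hclosed cW cW' (fun t ht x => (hopen t ht x).1) t ht x)
    (hclosed cZ cZ' (fun t ht x => (hopen t ht x).2) t ht x)

/-! ### Recovering the state, and the main theorem -/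

/-- The density with Riemann invariants `W` and `Z`. -/
noncomputable def densityOf (γ W Z : ℝ) : ℝ := (theta γ / 2 * (W - Z)) ^ (theta γ)⁻¹

lemma densityOf_rpow {γ W Z : ℝ} (hγ : 1 < γ) (h : Z < W) :
    densityOf γ W Z ^ theta γ = theta γ / 2 * (W - Z) := by
  have hθ := theta_pos hγ
  exact Real.rpow_inv_rpow (by have := sub_pos.2 h; positivity) hθ.ne'

lemma w1_densityOf {γ W Z : ℝ} (hγ : 1 < γ) (h : Z < W) :
    w1 γ (densityOf γ W Z) ((W + Z) / 2) = W := by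
  have hθ := (theta_pos hγ).ne'
  rw [w1, densityOf_rpow hγ h]
  field_simp
  ring

lemma w2_densityOf {γ W Z : ℝ} (hγ : 1 < γ) (h : Z < W) :
    w2 γ (densityOf γ W Z) ((W + Z) / 2) = Z := by
  have hθ := (theta_pos hγ).ne'
  rw [w2, densityOf_rpow hγ h]
  field_simp
  ring

lemma densityOf_pos {γ W Z : ℝ} (hγ : 1 < γ) (h : Z < W) : 0 < densityOf γ W Z := by
  have hθ := theta_pos hγ
  have := sub_pos.2 h
  exact Real.rpow_pos_of_pos (by positivity) _

end Carroll

open Carroll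
theorem mainTheorem5 (γ : ℝ) (hγ : 1 < γ) (hγ' : γ ≤ 3) (σ₀ β₀ : ℝ → ℝ)
    (hσ₀ : ContDiff ℝ 1 σ₀) (hβ₀ : ContDiff ℝ 1 β₀)
    (hbdd : ∃ C : ℝ, ∀ x, |deriv σ₀ x| ≤ C ∧ |deriv β₀ x| ≤ C)
    (hpos : ∀ x, 0 ≤ σ₀ x)
    (hsign : Carroll.SignCondition γ σ₀ β₀)
    (hhyp : γ < 3 → Carroll.HyperbolicityCondition γ σ₀ β₀) :
    ∃ T : ℝ, 0 < T ∧ ∃ σ β : ℝ → ℝ → ℝ,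
      Carroll.IsC1CauchySolution γ T σ₀ β₀ σ β ∧
      (∀ σ' β' : ℝ → ℝ → ℝ, Carroll.IsC1CauchySolution γ T σ₀ β₀ σ' β' →
        ∀ t ∈ Set.Icc 0 T, ∀ x, σ' t x = σ t x ∧ β' t x = β t x) ∧
      (∀ t ∈ Set.Icc 0 T, Carroll.SignCondition γ (σ t) (β t)) ∧
      (γ < 3 → ∀ t ∈ Set.Icc 0 T, Carroll.HyperbolicityCondition γ (σ t) (β t)) := by
  have hθ := theta_pos hγ
  have hθ1 := theta_le_one hγ'
  obtain ⟨c, hc, hlc, hmc⟩ := exists_eigenvalue_bound hγ hγ' hsign hhyp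
  obtain ⟨hf, hg, C, hfC, hgC⟩ := contDiff_riemann_invariants hγ hγ' hσ₀ hβ₀ hbdd hpos hsign
  have hgap : ∀ x y, w2 γ (σ₀ y) (β₀ y) < w1 γ (σ₀ x) (β₀ x) := fun x y =>
    calc w2 γ (σ₀ y) (β₀ y) ≤ ⨆ x, w2 γ (σ₀ x) (β₀ x) := le_ciSup hsign.2.1 y
      _ < 0 := hsign.2.2.2
      _ < ⨅ x, w1 γ (σ₀ x) (β₀ x) := hsign.2.2.1
      _ ≤ w1 γ (σ₀ x) (β₀ x) := ciInf_le hsign.1 x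
  obtain ⟨T₀, hT₀, W, Z, hW0, hZ0, hWZ⟩ := exists_diagonal_solution
    (k₁ := (1 + theta γ) / 2) (k₂ := (1 - theta γ) / 2) hf hg hfC hgC (by linarith) (by linarith)
    (by ring) hc hlc hmc
  have hWZlt : ∀ y : ℝ × ℝ, |y.1| < T₀ → Z y < W y := fun y hy => by
    obtain ⟨-, -, ⟨a, ha⟩, ⟨b, hb⟩, -⟩ := hWZ y hy
    rw [← ha, ← hb]
    exact hgap a b
  set σ : ℝ → ℝ → ℝ := fun t x => densityOf γ (W (t, x)) (Z (t, x)) with hσ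
  set β : ℝ → ℝ → ℝ := fun t x => (W (t, x) + Z (t, x)) / 2 with hβ
  -- Halving the time places the closed interval inside the open strip `|t| < T₀`, so `σ` and `β`
  -- are `C¹` on a neighbourhood of it, including across `t = 0`.
  have hT : ∀ t ∈ Icc 0 (T₀ / 2), |t| < T₀ := fun t ht => by
    rw [abs_of_nonneg ht.1]
    linarith [ht.2]
  have e1 : ∀ y : ℝ × ℝ, |y.1| < T₀ → w1 γ (σ y.1 y.2) (β y.1 y.2) = W y :=
    fun y hy => w1_densityOf hγ (hWZlt y hy)
  have e2 : ∀ y : ℝ × ℝ, |y.1| < T₀ → w2 γ (σ y.1 y.2) (β y.1 y.2) = Z y :=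
    fun y hy => w2_densityOf hγ (hWZlt y hy)
  have hσpos : ∀ y : ℝ × ℝ, |y.1| < T₀ → 0 < σ y.1 y.2 :=
    fun y hy => densityOf_pos hγ (hWZlt y hy)
  have hβd : ∀ y : ℝ × ℝ, |y.1| < T₀ → ContDiffAt ℝ 1 (Function.uncurry β) y := fun y hy =>
    ((hWZ y hy).1.add (hWZ y hy).2.1).div_const 2
  have hσd : ∀ y : ℝ × ℝ, |y.1| < T₀ → ContDiffAt ℝ 1 (Function.uncurry σ) y := fun y hy =>
    (contDiffAt_const.mul ((hWZ y hy).1.sub (hWZ y hy).2.1)).rpow_const_of_ne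
      (mul_pos (half_pos hθ) (sub_pos.2 (hWZlt y hy))).ne'
  have hnear : ∀ y : ℝ × ℝ, |y.1| < T₀ → ∀ᶠ z in 𝓝 y, |z.1| < T₀ := fun y hy =>
    (isOpen_lt (by fun_prop) (by fun_prop) : IsOpen {z : ℝ × ℝ | |z.1| < T₀}).mem_nhds hy
  have hWd : ∀ y : ℝ × ℝ, |y.1| < T₀ → ∃ d : ℝ, |d| ≤ 2 * C ∧
      HasFDerivAt (fun y : ℝ × ℝ => w1 γ (σ y.1 y.2) (β y.1 y.2))
        (d • (ContinuousLinearMap.snd ℝ ℝ ℝ -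
          (β y.1 y.2 + σ y.1 y.2 ^ theta γ)⁻¹ • ContinuousLinearMap.fst ℝ ℝ ℝ)) y := by
    intro y hy
    obtain ⟨-, -, -, -, ⟨d, hd, hder⟩, -⟩ := hWZ y hy
    rw [← e1 y hy, ← e2 y hy, first_eigenvalue_eq hγ] at hder
    exact ⟨d, hd, hder.congr_of_eventuallyEq ((hnear y hy).mono e1)⟩
  have hZd : ∀ y : ℝ × ℝ, |y.1| < T₀ → ∃ d : ℝ, |d| ≤ 2 * C ∧
      HasFDerivAt (fun y : ℝ × ℝ => w2 γ (σ y.1 y.2) (β y.1 y.2))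
        (d • (ContinuousLinearMap.snd ℝ ℝ ℝ -
          (β y.1 y.2 - σ y.1 y.2 ^ theta γ)⁻¹ • ContinuousLinearMap.fst ℝ ℝ ℝ)) y := by
    intro y hy
    obtain ⟨-, -, -, -, -, ⟨d, hd, hder⟩⟩ := hWZ y hy
    rw [← e1 y hy, ← e2 y hy, second_eigenvalue_eq hγ] at hder
    exact ⟨d, hd, hder.congr_of_eventuallyEq ((hnear y hy).mono e2)⟩
  have r1 : ∀ t ∈ Icc 0 (T₀ / 2), ∀ x,
      w1 γ (σ t x) (β t x) ∈ range fun x => w1 γ (σ₀ x) (β₀ x) := fun t ht x => by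
    rw [e1 (t, x) (hT t ht)]
    exact (hWZ (t, x) (hT t ht)).2.2.1
  have r2 : ∀ t ∈ Icc 0 (T₀ / 2), ∀ x,
      w2 γ (σ t x) (β t x) ∈ range fun x => w2 γ (σ₀ x) (β₀ x) := fun t ht x => by
    rw [e2 (t, x) (hT t ht)]
    exact (hWZ (t, x) (hT t ht)).2.2.2.1
  have hl : ∀ t ∈ Icc 0 (T₀ / 2), ∀ x, c ≤ β t x + σ t x ^ theta γ := fun t ht x => by
    obtain ⟨a, ha⟩ := r1 t ht x
    obtain ⟨b, hb⟩ := r2 t ht x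
    rw [← first_eigenvalue_eq hγ, ← ha, ← hb]
    exact hlc a b
  have hm : ∀ t ∈ Icc 0 (T₀ / 2), ∀ x, β t x - σ t x ^ theta γ ≤ -c := fun t ht x => by
    obtain ⟨a, ha⟩ := r1 t ht x
    obtain ⟨b, hb⟩ := r2 t ht x
    rw [← second_eigenvalue_eq hγ, ← ha, ← hb]
    exact hmc a b
  have heq : ∀ t ∈ Ioo 0 (T₀ / 2), ∀ x,
      deriv (fun s => β s x * σ s x) t + deriv (fun y => σ t y) x = 0 ∧
      deriv (fun s => γ⁻¹ * σ s x ^ γ + β s x ^ 2 * σ s x) t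
        + deriv (fun y => β t y * σ t y) x = 0 := by
    intro t ht x
    have ht' := Ioo_subset_Icc_self ht
    have hy : |((t, x) : ℝ × ℝ).1| < T₀ := hT t ht'
    obtain ⟨A, B, hA, hB, hiff⟩ := fluid_equations_iff hγ (hσpos (t, x) hy)
      ((hσd (t, x) hy).differentiableAt one_ne_zero).hasFDerivAt
      ((hβd (t, x) hy).differentiableAt one_ne_zero).hasFDerivAt
    obtain ⟨d, -, hd⟩ := hWd (t, x) hy
    obtain ⟨d', -, hd'⟩ := hZd (t, x) hy
    have n1 : β t x + σ t x ^ theta γ ≠ 0 := by linarith [hl t ht' x]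
    have n2 : β t x - σ t x ^ theta γ ≠ 0 := by linarith [hm t ht' x]
    refine hiff.2 ⟨?_, ?_⟩
    · rw [hA.unique hd]
      simp
      field_simp
      ring
    · rw [hB.unique hd']
      simp
      field_simp
      ring
  have hzero : ∀ x, σ 0 x = σ₀ x ∧ β 0 x = β₀ x := fun x => by
    have h0 : |((0, x) : ℝ × ℝ).1| < T₀ := by simpa using hT₀
    exact state_eq_of_invariants_eq hγ (hpos x) (hσpos (0, x) h0).le
      ((e1 (0, x) h0).trans (hW0 x)) ((e2 (0, x) h0).trans (hZ0 x))
  have hsol : IsC1CauchySolution γ (T₀ / 2) σ₀ β₀ σ β :=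
    { contDiffOn_sigma := fun y hy => (hσd y (hT _ hy.1)).contDiffWithinAt
      contDiffOn_beta := fun y hy => (hβd y (hT _ hy.1)).contDiffWithinAt
      sigma_nonneg := fun t ht x => (hσpos (t, x) (hT t ht)).le
      energy := fun t ht x => (heq t ht x).1
      momentum := fun t ht x => (heq t ht x).2
      sigma_zero := fun x => (hzero x).1
      beta_zero := fun x => (hzero x).2 }
  exact ⟨T₀ / 2, half_pos hT₀, σ, β, hsol, fun σ' β' hsol' =>
    solution_unique hγ hγ' (half_pos hT₀) hc hsol hsol' hl hm
      (fun t ht x => hWd (t, x) (hT t (Ioo_subset_Icc_self ht)))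
      (fun t ht x => hZd (t, x) (hT t (Ioo_subset_Icc_self ht))),
    fun t ht => hsign.of_range_subset (r1 t ht) (r2 t ht),
    fun h3 t ht => (hhyp h3).of_range_subset hγ (r1 t ht) (r2 t ht)⟩
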